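/- Let $(W_i)_{i\ge 1}$ be independent standard Wiener processes and let $(g_i)_{i\ge1}$ be real-valued random variables on the same probability space (no condition on the $g_i$ is needed). Let $\sigma_{(1)},\tilde\sigma:[0,1]\to(0,\infty)$ be continuous functions such that $\tilde\sigma/\sigma_{(1)}$ is not constant, let $\theta\in(0,1)$, let $(a_N)_{N\in\mathbb N}$ be a bounded sequence of positive numbers, and let $K=K_N$ be natural numbers with $K_N\to\infty$, $a_N\sqrt{NK_N}\to\infty$ and $a_NK_N\to\infty$ as $N\to\infty$. For each $N$ put $\sigma_{(2)}:=\sigma_{(1)}+a_N\tilde\sigma$ and let the curves $R_1,\dots,R_N$ be given by $$R_i(t)=\exp(g_i)\int_0^t\sigma_i(u)\,dW_i(u),\quad t\in[0,1],\qquad \sigma_i=\sigma_{(1)}\ \text{for } i\le\lfloor N\theta\rfloor,\quad \sigma_i=\sigma_{(2)}\ \text{for } i>\lfloor N\theta\rfloor .$$ For $u\in[0,1]$ let $$\widehat F_i(u):=\frac{\sum_{k=1}^{K}|R_i(k/K)-R_i((k-1)/K)|^2\,\mathbb I\{k/K\le u\}}{\sum_{k=1}^{K}|R_i(k/K)-R_i((k-1)/K)|^2},$$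 and let $$\hat\theta^{(1)}:=\frac1N\operatorname*{argmax}_{n\in\{1,\dots,N\}}\int_0^1\Big(\sum_{i=1}^n\widehat F_i(u)-\frac nN\sum_{i=1}^N\widehat F_i(u)\Big)^2du,$$ where any maximizer may be chosen. Then, as $N\to\infty$, $$\hat\theta^{(1)}-\theta=\mathcal O_P\Big(\max\Big\{\frac{a_N^{-2}}{NK_N},\frac1N\Big\}\Big),$$ that is, for every $\varepsilon>0$ there are $C>0$ and $N_0$ with $\mathbb P\big(|\hat\theta^{(1)}-\theta|>C\max\{a_N^{-2}/(NK_N),1/N\}\big)\le\varepsilon$ for all $N\ge N_0$. -/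

import Mathlib

open MeasureTheory ProbabilityTheory Filter Topology
open scoped NNReal ENNReal

/-- The elementary Itô integral up to time `t` of the step function which equals `ν (j / m)` on
`(j / m, (j + 1) / m]`, with respect to the process `W`:
`∑_{j < m} ν(j/m) (W((j+1)/m ∧ t) - W(j/m ∧ t))`, for `t ∈ [0, 1]`. -/
noncomputable def elementaryItoIntegral {Ω : Type*} (W : ℝ≥0 → Ω → ℝ) (ν : ℝ → ℝ) (m : ℕ)
    (t : ℝ) (ω : Ω) : ℝ :=
  ∑ j ∈ Finset.range m, ν ((j : ℝ) / m) *
    (W (min (((j + 1 : ℕ) : ℝ) / m) t).toNNReal ω - W (min ((j : ℝ) / m) t).toNNReal ω)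

/-- `Y` is a version of the Itô integral `∫₀ᵗ ν(u) dW(u)` of the deterministic integrand `ν`
(continuous on `[0, 1]`): it is the `L²(P)`-limit of the elementary integrals of the left-endpoint
step functions of `ν`. -/
def IsItoIntegralAt {Ω : Type*} [MeasurableSpace Ω] (P : Measure Ω) (W : ℝ≥0 → Ω → ℝ)
    (ν : ℝ → ℝ) (t : ℝ) (Y : Ω → ℝ) : Prop :=
  MemLp Y 2 P ∧
    Tendsto (fun m : ℕ => eLpNorm (elementaryItoIntegral W ν m t - Y) 2 P) atTop (𝓝 0)

lemma sum_range_mul_blocks (f g : ℕ → ℝ) (p n : ℕ) (hp : 0 < p) :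
    ∑ j ∈ Finset.range n, f j * (g ((j + 1) * p) - g (j * p)) =
      ∑ r ∈ Finset.range (n * p), f (r / p) * (g (r + 1) - g r) := by
  induction n with
  | zero => simp
  | succ n ih =>
    rw [Finset.sum_range_succ, ih, Nat.succ_mul, Finset.sum_range_add]
    congr 1
    have h : ∀ x ∈ Finset.range p, f ((n * p + x) / p) * (g (n * p + x + 1) - g (n * p + x)) =
        f n * (g (n * p + (x + 1)) - g (n * p + x)) := by
      intro x hx
      have hx' := Finset.mem_range.1 hx
      rw [show (n * p + x) / p = n from by
        rw [Nat.add_comm, Nat.add_mul_div_right _ _ hp, Nat.div_eq_of_lt hx', Nat.zero_add]]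
      rfl
    rw [Finset.sum_congr rfl h, ← Finset.mul_sum,
      Finset.sum_range_sub (fun x => g (n * p + x)), Nat.add_zero]

lemma eLpNorm_sum_increments_le {Ω : Type*} [MeasurableSpace Ω] {P : Measure Ω}
    {W : ℝ≥0 → Ω → ℝ} (hW : IsPreBrownianReal W P) (τ : ℕ → ℝ≥0) (hτ : Monotone τ)
    (hτ1 : ∀ r, τ r ≤ 1)
    (c : ℕ → ℝ) (M : ℕ) (C : ℝ) (hC : 0 ≤ C) (hc : ∀ r < M, |c r| ≤ C) :
    eLpNorm (fun ω => ∑ r ∈ Finset.range M, c r * (W (τ (r + 1)) ω - W (τ r) ω)) 2 P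
      ≤ ENNReal.ofReal C := by
  have : IsProbabilityMeasure P := hW.isGaussianProcess.isProbabilityMeasure
  have hmem : ∀ r, MemLp (W (τ (r + 1)) - W (τ r)) 2 P := fun r =>
    (hW.hasLaw_sub _ _).hasGaussianLaw.memLp_two
  have hmem' : ∀ r, MemLp (fun ω => c r * (W (τ (r + 1)) ω - W (τ r) ω)) 2 P := fun r =>
    (hmem r).const_mul _
  have hsum : MemLp (fun ω => ∑ r ∈ Finset.range M, c r * (W (τ (r + 1)) ω - W (τ r) ω)) 2 P :=
    memLp_finsetSum _ fun r _ => hmem' r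
  have hint : ∫ ω, ∑ r ∈ Finset.range M, c r * (W (τ (r + 1)) ω - W (τ r) ω) ∂P = 0 := by
    rw [integral_finsetSum _ fun r _ => (hmem' r).integrable (by norm_num)]
    refine Finset.sum_eq_zero fun r _ => ?_
    rw [integral_const_mul, integral_sub (hW.integrable_eval _) (hW.integrable_eval _),
      hW.integral_eval, hW.integral_eval]
    simp
  have hvar : Var[fun ω => ∑ r ∈ Finset.range M, c r * (W (τ (r + 1)) ω - W (τ r) ω); P]
      ≤ C ^ 2 := by
    have hind := hW.hasIndepIncrements.nat hτ
    have h1 := IndepFun.variance_sum (μ := P) (s := Finset.range M)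
      (X := fun r ω => c r * (W (τ (r + 1)) ω - W (τ r) ω)) (fun r _ => hmem' r)
      (fun i _ j _ hij => (hind.indepFun hij).comp (φ := fun x => c i * x)
        (ψ := fun x => c j * x) (by fun_prop) (by fun_prop))
    have h2 : (∑ r ∈ Finset.range M, fun ω => c r * (W (τ (r + 1)) ω - W (τ r) ω)) =
        fun ω => ∑ r ∈ Finset.range M, c r * (W (τ (r + 1)) ω - W (τ r) ω) := by
      ext ω; simp
    rw [← h2, h1]
    have h3 : ∀ r ∈ Finset.range M, Var[fun ω => c r * (W (τ (r + 1)) ω - W (τ r) ω); P] ≤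
        C ^ 2 * ((τ (r + 1) : ℝ) - τ r) := by
      intro r hr
      have hv : Var[fun ω => W (τ (r + 1)) ω - W (τ r) ω; P] = (τ (r + 1) : ℝ) - τ r := by
        have := (hW.hasLaw_sub (τ (r + 1)) (τ r)).variance_eq
        rw [variance_id_gaussianReal] at this
        have h5 : (τ r : ℝ) ≤ τ (r + 1) := by exact_mod_cast hτ (Nat.le_succ r)
        have h6 : ((nndist (τ (r + 1)).1 (τ r).1 : ℝ≥0) : ℝ) = (τ (r + 1) : ℝ) - τ r := by
          rw [coe_nndist, Real.dist_eq, abs_of_nonneg]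
          · rfl
          · exact sub_nonneg.2 h5
        rw [← h6, ← this]
        rfl
      rw [variance_const_mul, hv]
      have h4 : (τ r : ℝ) ≤ τ (r + 1) := by exact_mod_cast hτ (Nat.le_succ r)
      have := hc r (Finset.mem_range.1 hr)
      exact mul_le_mul_of_nonneg_right (sq_le_sq' (by linarith [neg_le_of_abs_le this])
        (le_of_abs_le this)) (by linarith)
    refine (Finset.sum_le_sum h3).trans ?_
    rw [← Finset.mul_sum, Finset.sum_range_sub (fun r => (τ r : ℝ))]
    have h7 : (τ M : ℝ) ≤ 1 := by exact_mod_cast hτ1 M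
    have h8 : (0 : ℝ) ≤ τ 0 := (τ 0).2
    nlinarith [sq_nonneg C]
  rw [variance_of_integral_eq_zero hsum.aestronglyMeasurable.aemeasurable hint] at hvar
  rw [hsum.eLpNorm_eq_integral_rpow_norm (by norm_num) (by norm_num)]
  refine ENNReal.ofReal_le_ofReal ?_
  have h9 : (∫ ω, ‖∑ r ∈ Finset.range M, c r * (W (τ (r + 1)) ω - W (τ r) ω)‖ ^
      (2 : ℝ≥0∞).toReal ∂P) ≤ C ^ 2 := by
    refine le_trans (le_of_eq ?_) hvar
    refine integral_congr_ae (Eventually.of_forall fun ω => ?_)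
    simp
  calc _ ≤ (C ^ 2) ^ ((2 : ℝ≥0∞).toReal⁻¹) :=
        Real.rpow_le_rpow (integral_nonneg fun ω => by positivity) h9 (by positivity)
    _ = C := by
        rw [← Real.rpow_natCast, ← Real.rpow_mul hC]; simp

lemma memLp_elementaryItoIntegral {Ω : Type*} [MeasurableSpace Ω] {P : Measure Ω}
    {W : ℝ≥0 → Ω → ℝ} (hW : IsPreBrownianReal W P) (ν : ℝ → ℝ) (m : ℕ) (t : ℝ) :
    MemLp (elementaryItoIntegral W ν m t) 2 P :=
  memLp_finsetSum _ fun _ _ => MemLp.const_mul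
    ((hW.hasLaw_sub _ _).hasGaussianLaw.memLp_two) _

lemma eLpNorm_elementaryItoIntegral_sub_le {Ω : Type*} [MeasurableSpace Ω] {P : Measure Ω}
    {W : ℝ≥0 → Ω → ℝ} (hW : IsPreBrownianReal W P) (ν : ℝ → ℝ) (t : ℝ) (m p : ℕ)
    (hm : 0 < m) (hp : 0 < p) (ht : t ≤ 1) (ε : ℝ) (hε : 0 ≤ ε)
    (hν : ∀ x ∈ Set.Icc (0 : ℝ) 1, ∀ y ∈ Set.Icc (0 : ℝ) 1, |x - y| ≤ 1 / m →
      |ν x - ν y| ≤ ε) :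
    eLpNorm (elementaryItoIntegral W ν m t - elementaryItoIntegral W ν (m * p) t) 2 P
      ≤ ENNReal.ofReal ε := by
  set τ : ℕ → ℝ≥0 := fun r => (min ((r : ℝ) / (m * p : ℕ)) t).toNNReal with hτ
  have hm' : (0 : ℝ) < m := by exact_mod_cast hm
  have hp' : (0 : ℝ) < p := by exact_mod_cast hp
  have key : elementaryItoIntegral W ν m t - elementaryItoIntegral W ν (m * p) t =
      fun ω => ∑ r ∈ Finset.range (m * p), (ν (((r / p : ℕ) : ℝ) / m) - ν ((r : ℝ) / (m * p : ℕ)))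
        * (W (τ (r + 1)) ω - W (τ r) ω) := by
    ext ω
    have h := sum_range_mul_blocks (fun j => ν ((j : ℝ) / m)) (fun r => W (τ r) ω) p m hp
    have e : ∀ j : ℕ, τ (j * p) = (min ((j : ℝ) / m) t).toNNReal := by
      intro j
      simp only [hτ]
      congr 2
      push_cast
      field_simp
    simp only [e] at h
    simp only [Pi.sub_apply, elementaryItoIntegral, sub_mul, Finset.sum_sub_distrib]
    rw [h]
  rw [key]
  refine eLpNorm_sum_increments_le hW τ ?_ ?_ _ _ ε hε ?_
  · intro a b hab
    simp only [hτ]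
    gcongr
  · intro r
    simp only [hτ]
    rw [Real.toNNReal_le_one]
    exact (min_le_right _ _).trans ht
  · intro r hr
    have hr' : (r : ℝ) < m * p := by exact_mod_cast hr
    have h1 : (((r / p : ℕ) : ℝ)) * p ≤ r := by exact_mod_cast Nat.div_mul_le_self r p
    have h2 : (r : ℝ) < ((r / p : ℕ) + 1 : ℝ) * p := by
      have h3 : r < (r / p + 1) * p := by
        rw [Nat.mul_comm]; exact Nat.lt_mul_div_succ r hp
      exact_mod_cast h3
    have hmp : (0 : ℝ) < m * p := by positivity
    have e1 : (((r / p : ℕ) : ℝ)) / m ≤ (r : ℝ) / (m * p : ℕ) := by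
      push_cast
      rw [div_le_div_iff₀ hm' hmp]; nlinarith
    have e2 : (r : ℝ) / (m * p : ℕ) ≤ (((r / p : ℕ) : ℝ)) / m + 1 / m := by
      push_cast
      rw [← add_div, div_le_div_iff₀ hmp hm']; nlinarith
    have e3 : (r : ℝ) / (m * p : ℕ) ≤ 1 := by
      push_cast
      rw [div_le_one hmp]; exact hr'.le
    have e0 : (0 : ℝ) ≤ (((r / p : ℕ) : ℝ)) / m := by positivity
    refine hν _ ⟨e0, e1.trans e3⟩ _ ⟨e0.trans e1, e3⟩ ?_
    rw [abs_le]; constructor <;> linarith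

/-- The Itô integral of a continuous function exists. -/
theorem exists_isItoIntegralAt {Ω : Type*} [MeasurableSpace Ω] {P : Measure Ω}
    {W : ℝ≥0 → Ω → ℝ} (hW : IsPreBrownianReal W P) {ν : ℝ → ℝ}
    (hν : ContinuousOn ν (Set.Icc 0 1)) {t : ℝ} (ht : t ≤ 1) :
    ∃ Y, IsItoIntegralAt P W ν t Y := by
  have hmem := fun m => memLp_elementaryItoIntegral hW ν m t
  let S : ℕ → Lp ℝ 2 P := fun m => (hmem m).toLp _
  have huc := (isCompact_Icc (a := (0 : ℝ)) (b := 1)).uniformContinuousOn_of_continuous hν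
  rw [Metric.uniformContinuousOn_iff_le] at huc
  have hcau : CauchySeq S := by
    rw [Metric.cauchySeq_iff]
    intro ε hε
    obtain ⟨δ, hδ, h⟩ := huc (ε / 3) (by positivity)
    obtain ⟨n0, hn0⟩ := exists_nat_one_div_lt hδ
    have hstep : ∀ m ≥ n0 + 1, ∀ p, 0 < p → dist (S m) (S (m * p)) ≤ ε / 3 := by
      intro m hm p hp
      have h1 := eLpNorm_elementaryItoIntegral_sub_le hW ν t m p (by omega) hp ht (ε / 3)
        (by positivity) (fun x hx y hy hxy => by
          have := h x hx y hy (by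
            rw [Real.dist_eq]
            refine hxy.trans (le_trans ?_ hn0.le)
            apply one_div_le_one_div_of_le (by positivity)
            exact_mod_cast hm)
          rwa [Real.dist_eq] at this)
      rw [dist_edist, Lp.edist_toLp_toLp]
      exact ENNReal.toReal_le_of_le_ofReal (by positivity) h1
    refine ⟨n0 + 1, fun m hm n hn => ?_⟩
    have h1 := hstep m hm n (by omega)
    have h2 := hstep n hn m (by omega)
    rw [mul_comm n m, dist_comm] at h2
    linarith [dist_triangle (S m) (S (m * n)) (S n)]
  obtain ⟨Y, hY⟩ := cauchySeq_tendsto_of_complete hcau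
  refine ⟨Y, Lp.memLp Y, ?_⟩
  have := (Lp.tendsto_Lp_iff_tendsto_eLpNorm S Y (Lp.memLp Y)).1 (by simpa using hY)
  refine this.congr fun m => eLpNorm_congr_ae ?_
  filter_upwards [(hmem m).coeFn_toLp] with ω hω
  simp [S, hω]

/-- The Itô integral is unique up to a null set. -/
theorem IsItoIntegralAt.ae_eq {Ω : Type*} [MeasurableSpace Ω] {P : Measure Ω}
    {W : ℝ≥0 → Ω → ℝ} (hW : IsPreBrownianReal W P) {ν : ℝ → ℝ} {t : ℝ} {Y Z : Ω → ℝ}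
    (hY : IsItoIntegralAt P W ν t Y) (hZ : IsItoIntegralAt P W ν t Z) : Y =ᵐ[P] Z := by
  have h1 := tendstoInMeasure_of_tendsto_eLpNorm (by norm_num)
    (fun m => (memLp_elementaryItoIntegral hW ν m t).aestronglyMeasurable)
    hY.1.aestronglyMeasurable hY.2
  have h2 := tendstoInMeasure_of_tendsto_eLpNorm (by norm_num)
    (fun m => (memLp_elementaryItoIntegral hW ν m t).aestronglyMeasurable)
    hZ.1.aestronglyMeasurable hZ.2
  exact tendstoInMeasure_ae_unique h1 h2

open Classical in
/-- The Itô integral `∫₀ᵗ ν(u) dW(u)`, `t ∈ [0, 1]`, of a deterministic continuous function `ν` with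
respect to `W`, as a random variable determined up to a null set. The value `0` is used only if the
defining `L²`-limit does not exist, which does not happen for a Brownian motion `W`. -/
noncomputable def itoIntegral {Ω : Type*} [MeasurableSpace Ω] (P : Measure Ω)
    (W : ℝ≥0 → Ω → ℝ) (ν : ℝ → ℝ) (t : ℝ) : Ω → ℝ :=
  if h : ∃ Y, IsItoIntegralAt P W ν t Y then h.choose else 0

theorem isItoIntegralAt_itoIntegral {Ω : Type*} [MeasurableSpace Ω] {P : Measure Ω}
    {W : ℝ≥0 → Ω → ℝ} (hW : IsPreBrownianReal W P) {ν : ℝ → ℝ}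
    (hν : ContinuousOn ν (Set.Icc 0 1)) {t : ℝ} (ht : t ≤ 1) :
    IsItoIntegralAt P W ν t (itoIntegral P W ν t) := by
  have h := exists_isItoIntegralAt hW hν ht
  rw [itoIntegral, dif_pos h]
  exact h.choose_spec

/-- The volatility function of the `i`-th curve in a sample of size `N`: `σ₁` up to the change
`⌊N θ⌋`, and `σ₂` afterwards. -/
noncomputable def changeVolatility (σ₁ σ₂ : ℝ → ℝ) (θ : ℝ) (N i : ℕ) : ℝ → ℝ :=
  if i ≤ ⌊(N : ℝ) * θ⌋₊ then σ₁ else σ₂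

/-- The realized quadratic variation `Q̂(t) = ∑_{k=1}^K |R(k/K) - R((k-1)/K)|² 1{k/K ≤ t}` of
a curve `R`. -/
noncomputable def realizedQV (R : ℝ → ℝ) (K : ℕ) (t : ℝ) : ℝ :=
  ∑ k ∈ Finset.Icc 1 K,
    if (k : ℝ) / K ≤ t then |R ((k : ℝ) / K) - R (((k : ℝ) - 1) / K)| ^ 2 else 0

/-- The standardized realized quadratic variation `F̂(t) = Q̂(t) / Q̂(1)` of a curve `R`. -/
noncomputable def standardizedQV (R : ℝ → ℝ) (K : ℕ) (t : ℝ) : ℝ :=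
  realizedQV R K t / realizedQV R K 1

/-- The CUSUM objective
`∫₀¹ (∑_{i=1}^n F_i(u) - (n/N) ∑_{i=1}^N F_i(u))² du`. -/
noncomputable def cusum (F : ℕ → ℝ → ℝ) (N n : ℕ) : ℝ :=
  ∫ u in (0 : ℝ)..1, (∑ i ∈ Finset.Icc 1 n, F i u -
    (n : ℝ) / N * ∑ i ∈ Finset.Icc 1 N, F i u) ^ 2

/-- `θhat = n / N` for a maximizer `n` of the CUSUM objective over `{1, …, N}`. -/
def IsCusumArgmax (F : ℕ → ℝ → ℝ) (N : ℕ) (θhat : ℝ) : Prop :=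
  ∃ n ∈ Finset.Icc 1 N, (∀ m ∈ Finset.Icc 1 N, cusum F N m ≤ cusum F N n) ∧
    θhat = (n : ℝ) / N

/-- `X_N = O_P(r_N)` as `N → ∞`: for every `ε > 0` there is a constant `C` with
`P(|X_N| > C r_N) ≤ ε` for all large `N`. -/
def IsBigOInProbability {Ω : Type*} [MeasurableSpace Ω] (P : Measure Ω)
    (X : ℕ → Ω → ℝ) (r : ℕ → ℝ) : Prop :=
  ∀ ε : ℝ, 0 < ε → ∃ C : ℝ, 0 < C ∧ ∃ N₀ : ℕ, ∀ N ≥ N₀,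
    P {ω | C * r N < |X N ω|} ≤ ENNReal.ofReal ε

/-! The estimator is the argmax of the norm of a CUSUM vector in a Hilbert space. Each standardized
quadratic variation is constant on the cells of the grid of mesh `1 / K`, so its `L²` norm is
exactly a normalized Euclidean norm in dimension `K` (`cusum_eq_norm_sq_cusumVec`). The factor `exp
(g i)` cancels in the quotient, so the vector of curve `i` is almost surely a function of `W i`
alone. The vectors are therefore independent whatever the `g i` are.

The `i`-th vector has bias and variance of order `1 / K` around one of two deterministic vectors
`f₁`, `f₂` (`exists_measurable_standardizedQV_vector`). The linear part of the error of a quotient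
is centred, so the bias has the order of the variance and not of its square root. The jump `‖f₁ -
f₂‖` is at least a constant times `a` (`exists_mul_sq_le_sum_grid_stdIntegratedSq`), so `a K → ∞`
makes the bias negligible.

Without noise the CUSUM vector at `n` is a tent function of `n`, with peak at the change `k`, times
`f₁ - f₂`. Since `‖x‖² - ‖y‖² = ⟪x - y, x + y⟫`, the value at `k` beats the value at `n` as soon as
the noise sums are small relative to `N ‖f₁ - f₂‖` and the noise summed between `k` and `n` is small
relative to `|n - k| ‖f₁ - f₂‖` (`norm_cusumVec_lt`). Kolmogorov's inequality gives the first up to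
probability of order `1 / (a² N K)`, which tends to zero. The Hájek–Rényi inequality gives the
second for all `|n - k| ≥ D` at once, up to probability of order `1 / (a² K D)`. Taking `D` a large
multiple of `max (a⁻² / K) 1` and dividing by `N` gives the rate; the `1 / N` also absorbs the
rounding of `N θ`. -/

/-! ### Deterministic analysis of the CUSUM vector. -/

section CusumVector

variable {H : Type*} [NormedAddCommGroup H] [InnerProductSpace ℝ H]

/-- The CUSUM vector `∑_{i ≤ n} x i - (n / N) ∑_{i ≤ N} x i`. -/
noncomputable def cusumVec (x : ℕ → H) (N n : ℕ) : H :=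
  ∑ i ∈ Finset.Icc 1 n, x i - ((n : ℝ) / N) • ∑ i ∈ Finset.Icc 1 N, x i

lemma cusumVec_add (x y : ℕ → H) (N n : ℕ) :
    cusumVec (fun i => x i + y i) N n = cusumVec x N n + cusumVec y N n := by
  simp only [cusumVec, Finset.sum_add_distrib, smul_add]
  abel

lemma sum_Icc_ite_le (f₁ f₂ : H) (k n : ℕ) :
    ∑ i ∈ Finset.Icc 1 n, (if i ≤ k then f₁ else f₂) =
      (n : ℝ) • f₂ + ((min n k : ℕ) : ℝ) • (f₁ - f₂) := by
  induction n with
  | zero => simp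
  | succ n ih =>
    rw [Finset.sum_Icc_succ_top (by omega), ih]
    by_cases h : n + 1 ≤ k
    · rw [if_pos h, min_eq_left h, min_eq_left (by omega)]
      push_cast
      module
    · rw [if_neg h, min_eq_right (by omega), min_eq_right (by omega)]
      push_cast
      module

/-- The coefficient is a tent function of `n`: it rises with slope `1 - k / N` up to `k`, then falls
with slope `k / N` to zero at `N`. -/
lemma cusumVec_ite_le (f₁ f₂ : H) {k N : ℕ} (hN : 0 < N) (hk : k ≤ N) (n : ℕ) :
    cusumVec (fun i => if i ≤ k then f₁ else f₂) N n =
      (((min n k : ℕ) : ℝ) - (n : ℝ) / N * k) • (f₁ - f₂) := by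
  have hN' : (N : ℝ) ≠ 0 := by positivity
  rw [cusumVec, sum_Icc_ite_le, sum_Icc_ite_le, min_eq_right hk, smul_add, smul_smul, smul_smul,
    div_mul_cancel₀ _ hN']
  module

/-- The difference of the squared norms is the inner product of the difference and the sum of the
two vectors. Each of these is a positive multiple of `δ` up to a relative error `1 / 4`, so the
inner product is at least `1 - 1/4 - 1/4 - 1/16 > 0` times its noiseless value. Measuring `E - E'`
against `h - h'` is what lets the noise be compared with the distance from the change. -/
lemma norm_lt_norm_of_perturbed_smul {δ E E' : H} {h h' : ℝ} (hδ : δ ≠ 0) (hlt : h' < h)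
    (hpos : 0 < h + h') (hsum : ‖E + E'‖ ≤ (h + h') / 4 * ‖δ‖)
    (hdiff : ‖E - E'‖ ≤ (h - h') / 4 * ‖δ‖) : ‖h' • δ + E'‖ < ‖h • δ + E‖ := by
  have hδ' : 0 < ‖δ‖ := norm_pos_iff.2 hδ
  have key : ‖h • δ + E‖ ^ 2 - ‖h' • δ + E'‖ ^ 2 =
      inner ℝ ((h - h') • δ + (E - E')) ((h + h') • δ + (E + E')) := by
    rw [← real_inner_self_eq_norm_sq, ← real_inner_self_eq_norm_sq]
    simp only [inner_add_left, inner_add_right, inner_sub_left, inner_smul_left,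
      inner_smul_right, RCLike.conj_to_real]
    rw [real_inner_comm δ E, real_inner_comm δ E', real_inner_comm E' E]
    ring
  have h1 : inner ℝ ((h - h') • δ + (E - E')) ((h + h') • δ + (E + E')) =
      (h - h') * (h + h') * ‖δ‖ ^ 2 + (h - h') * inner ℝ δ (E + E') +
        (h + h') * inner ℝ (E - E') δ + inner ℝ (E - E') (E + E') := by
    rw [inner_add_left, inner_add_right (𝕜 := ℝ) ((h - h') • δ), inner_add_right (𝕜 := ℝ) (E - E')]
    simp only [inner_smul_left, inner_smul_right, RCLike.conj_to_real]
    rw [real_inner_self_eq_norm_sq]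
    ring
  have h2 : -(‖δ‖ * ((h + h') / 4 * ‖δ‖)) ≤ inner ℝ δ (E + E') := by
    have := abs_real_inner_le_norm δ (E + E')
    have h3 := neg_abs_le (inner ℝ δ (E + E'))
    have h4 := mul_le_mul_of_nonneg_left hsum hδ'.le
    linarith
  have h3 : -(((h - h') / 4 * ‖δ‖) * ‖δ‖) ≤ inner ℝ (E - E') δ := by
    have := abs_real_inner_le_norm (E - E') δ
    have h3 := neg_abs_le (inner ℝ (E - E') δ)
    have h4 := mul_le_mul_of_nonneg_right hdiff hδ'.le
    linarith
  have h4 : -(((h - h') / 4 * ‖δ‖) * ((h + h') / 4 * ‖δ‖)) ≤ inner ℝ (E - E') (E + E') := by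
    have := abs_real_inner_le_norm (E - E') (E + E')
    have h3 := neg_abs_le (inner ℝ (E - E') (E + E'))
    have h4 := mul_le_mul hdiff hsum (norm_nonneg _) ((norm_nonneg _).trans hdiff)
    linarith
  have hd : 0 < h - h' := by linarith
  have h5 : 0 < (h - h') * (h + h') * ‖δ‖ ^ 2 := by positivity
  have h6 := mul_le_mul_of_nonneg_left h2 hd.le
  have h7 := mul_le_mul_of_nonneg_left h3 hpos.le
  refine lt_of_pow_lt_pow_left₀ 2 (norm_nonneg _) ?_
  nlinarith

/-- If the perturbations `η` are small on average, the CUSUM vector of a step function plus `η` is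
strictly longer at the change point `k` than at `n`. -/
theorem norm_cusumVec_lt {f₁ f₂ : H} {η : ℕ → H} {k N n : ℕ} {c : ℝ} (hδ : f₁ ≠ f₂) (hc : 0 < c)
    (hN : 0 < N) (hk1 : c * N ≤ k) (hk2 : (k : ℝ) ≤ (1 - c) * N) (hn : n ≤ N) (hnk : n ≠ k)
    (hη : ∀ m ≤ N, ‖∑ i ∈ Finset.Icc 1 m, η i‖ ≤ c ^ 2 / 16 * N * ‖f₁ - f₂‖)
    (hηn : ‖∑ i ∈ Finset.Icc 1 n, η i - ∑ i ∈ Finset.Icc 1 k, η i‖ ≤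
      c ^ 2 / 16 * |(n : ℝ) - k| * ‖f₁ - f₂‖) :
    ‖cusumVec (fun i => (if i ≤ k then f₁ else f₂) + η i) N n‖ <
      ‖cusumVec (fun i => (if i ≤ k then f₁ else f₂) + η i) N k‖ := by
  have hN' : (0 : ℝ) < N := by exact_mod_cast hN
  have hc1 : c ≤ 1 := by
    by_contra! h
    nlinarith [(Nat.cast_nonneg k : (0 : ℝ) ≤ k)]
  have hkN : k ≤ N := by
    have : (k : ℝ) ≤ N := by nlinarith
    exact_mod_cast this
  have hn' : (n : ℝ) ≤ N := by exact_mod_cast hn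
  have hkN' : (k : ℝ) ≤ N := by exact_mod_cast hkN
  have hδ' : 0 < ‖f₁ - f₂‖ := norm_pos_iff.2 (sub_ne_zero.2 hδ)
  rw [cusumVec_add, cusumVec_add, cusumVec_ite_le _ _ hN hkN, cusumVec_ite_le _ _ hN hkN]
  set δ := f₁ - f₂ with hδdef
  have hcus : ∀ m ≤ N, ‖cusumVec η N m‖ ≤ c ^ 2 / 8 * N * ‖δ‖ := by
    intro m hm
    have hm' : (m : ℝ) / N ≤ 1 := by
      rw [div_le_one hN']
      exact_mod_cast hm
    have h1 : ‖((m : ℝ) / N) • ∑ i ∈ Finset.Icc 1 N, η i‖ ≤ 1 * (c ^ 2 / 16 * N * ‖δ‖) := by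
      rw [norm_smul, Real.norm_of_nonneg (by positivity)]
      exact mul_le_mul hm' (hη N le_rfl) (norm_nonneg _) zero_le_one
    rw [cusumVec]
    linarith [norm_sub_le (∑ i ∈ Finset.Icc 1 m, η i) (((m : ℝ) / N) • ∑ i ∈ Finset.Icc 1 N, η i),
      hη m hm]
  have habs : 0 < |(n : ℝ) - k| := by
    rw [abs_pos, sub_ne_zero]
    exact_mod_cast hnk
  -- Both slopes of the tent, `1 - k / N` and `k / N`, are at least `c`.
  have hh : c * |(n : ℝ) - k| ≤
      (((min k k : ℕ) : ℝ) - (k : ℝ) / N * k) - (((min n k : ℕ) : ℝ) - (n : ℝ) / N * k) := by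
    have hkc : c ≤ (k : ℝ) / N := by rwa [le_div_iff₀ hN']
    have hkc' : (k : ℝ) / N ≤ 1 - c := by rwa [div_le_iff₀ hN']
    have e : (k : ℝ) / N * k = k * (k / N) := by ring
    have e' : (n : ℝ) / N * k = n * (k / N) := by ring
    rw [e, e', min_self]
    rcases le_total n k with h | h
    · have h' : (n : ℝ) ≤ k := by exact_mod_cast h
      rw [min_eq_left h, abs_of_nonpos (by linarith)]
      nlinarith
    · have h' : (k : ℝ) ≤ n := by exact_mod_cast h
      rw [min_eq_right h, abs_of_nonneg (by linarith)]
      nlinarith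
  have hhn : 0 ≤ ((min n k : ℕ) : ℝ) - (n : ℝ) / N * k := by
    have e' : (n : ℝ) / N * k = n * (k / N) := by ring
    have h1 : (k : ℝ) / N ≤ 1 := by rwa [div_le_one hN']
    have h0 : (n : ℝ) / N ≤ 1 := by rwa [div_le_one hN']
    rcases le_total n k with h | h
    · rw [min_eq_left h, e']
      nlinarith [(Nat.cast_nonneg n : (0 : ℝ) ≤ n)]
    · rw [min_eq_right h]
      nlinarith [(Nat.cast_nonneg k : (0 : ℝ) ≤ k)]
  -- The peak height is `k (1 - k / N)`, and both `k / N` and `1 - k / N` are at least `c`.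
  have hhk : c ^ 2 * N ≤ ((min k k : ℕ) : ℝ) - (k : ℝ) / N * k := by
    have hkc' : (k : ℝ) / N ≤ 1 - c := by rwa [div_le_iff₀ hN']
    have e : (k : ℝ) / N * k = k * (k / N) := by ring
    rw [e, min_self]
    have : (k : ℝ) * (k / N) ≤ k * (1 - c) := mul_le_mul_of_nonneg_left hkc' (Nat.cast_nonneg _)
    nlinarith
  refine norm_lt_norm_of_perturbed_smul (sub_ne_zero.2 hδ) (by nlinarith) ?_ ?_ ?_
  · have : 0 < c ^ 2 * N := by positivity
    linarith
  · refine (norm_add_le _ _).trans ?_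
    have h1 := hcus n hn
    have h2 := hcus k hkN
    have h3 : c ^ 2 * N / 4 * ‖δ‖ ≤ (((min k k : ℕ) : ℝ) - (k : ℝ) / N * k +
        (((min n k : ℕ) : ℝ) - (n : ℝ) / N * k)) / 4 * ‖δ‖ := by
      gcongr
      linarith
    linarith
  -- Moving from `k` to `n` changes the noise by the sum between the two points and by a share `(n -
  -- k) / N` of the total sum; each is at most `c² / 16 * |n - k| * ‖δ‖`.
  · have e : cusumVec η N k - cusumVec η N n =
        -(∑ i ∈ Finset.Icc 1 n, η i - ∑ i ∈ Finset.Icc 1 k, η i) +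
          (((n : ℝ) - k) / N) • ∑ i ∈ Finset.Icc 1 N, η i := by
      rw [cusumVec, cusumVec]
      module
    rw [e]
    refine (norm_add_le _ _).trans ?_
    rw [norm_neg, norm_smul, Real.norm_eq_abs, abs_div, abs_of_pos hN']
    have h1 : |(n : ℝ) - k| / N * ‖∑ i ∈ Finset.Icc 1 N, η i‖ ≤
        |(n : ℝ) - k| / N * (c ^ 2 / 16 * N * ‖δ‖) := by
      gcongr
      exact hη N le_rfl
    have h2 : |(n : ℝ) - k| / N * (c ^ 2 / 16 * N * ‖δ‖) = c ^ 2 / 16 * |(n : ℝ) - k| * ‖δ‖ := by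
      field_simp
    have h3 : c * |(n : ℝ) - k| / 4 * ‖δ‖ ≤ (((min k k : ℕ) : ℝ) - (k : ℝ) / N * k -
        (((min n k : ℕ) : ℝ) - (n : ℝ) / N * k)) / 4 * ‖δ‖ := by
      gcongr
    have h4 : c ^ 2 / 8 * |(n : ℝ) - k| * ‖δ‖ ≤ c * |(n : ℝ) - k| / 4 * ‖δ‖ := by
      have : c ^ 2 / 8 * (|(n : ℝ) - k| * ‖δ‖) ≤ c / 4 * (|(n : ℝ) - k| * ‖δ‖) :=
        mul_le_mul_of_nonneg_right (by nlinarith) (by positivity)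
      linarith
    linarith

end CusumVector

/-! ### Maximal inequalities for sums of independent Hilbert space valued variables. -/

section MaximalInequality

variable {Ω : Type*} [MeasurableSpace Ω] {P : Measure Ω}
  {H : Type*} [NormedAddCommGroup H] [InnerProductSpace ℝ H]

lemma MeasureTheory.MemLp.integrable_inner {X Y : Ω → H} (hX : MemLp X 2 P) (hY : MemLp Y 2 P) :
    Integrable (fun ω => inner ℝ (X ω) (Y ω)) P := by
  have h := hX.norm.integrable_mul hY.norm
  refine h.mono (hX.1.inner hY.1) (Eventually.of_forall fun ω => ?_)
  simpa using abs_real_inner_le_norm (X ω) (Y ω)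

variable [CompleteSpace H] [MeasurableSpace H] [BorelSpace H]

lemma ProbabilityTheory.IndepFun.integral_inner_eq_zero {X Y : Ω → H} (hXY : IndepFun X Y P)
    (hX : Integrable X P) (hY : Integrable Y P) (hY0 : ∫ ω, Y ω ∂P = 0) :
    ∫ ω, inner ℝ (X ω) (Y ω) ∂P = 0 := by
  have := hXY.integral_bilin hX hY (innerSL ℝ)
  rw [hY0, map_zero] at this
  exact this

variable {ξ : ℕ → Ω → H}

/-- A new summand `ξ (n + 1)` adds `2 ⟪S, ξ (n + 1)⟫ + ‖ξ (n + 1)‖²` to the squared norm. The cross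
term integrates to zero over every event `s` of the past, because `s.indicator S` is independent of
the centred `ξ (n + 1)`. The sum runs over `range (n + 1)` so that it is adapted at time `n`. -/
lemma submartingale_norm_sq_sum [IsProbabilityMeasure P] (hξ : ∀ i, StronglyMeasurable (ξ i))
    (hindep : iIndepFun ξ P) (hL2 : ∀ i, MemLp (ξ i) 2 P) (hmean : ∀ i, ∫ ω, ξ i ω ∂P = 0) :
    Submartingale (fun n ω => ‖∑ i ∈ Finset.range (n + 1), ξ i ω‖ ^ 2)
      (Filtration.natural ξ hξ) P := by
  have hadp : ∀ n, StronglyMeasurable[Filtration.natural ξ hξ n]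
      (fun ω => ∑ i ∈ Finset.range (n + 1), ξ i ω) := fun n =>
    Finset.stronglyMeasurable_fun_sum _ fun i hi =>
      ((Filtration.stronglyAdapted_natural hξ) i).mono
        ((Filtration.natural ξ hξ).mono (Nat.lt_succ_iff.1 (Finset.mem_range.1 hi)))
  have hS : ∀ n, MemLp (fun ω => ∑ i ∈ Finset.range (n + 1), ξ i ω) 2 P := fun n =>
    memLp_finsetSum _ fun i _ => hL2 i
  have hint : ∀ n, Integrable (fun ω => ‖∑ i ∈ Finset.range (n + 1), ξ i ω‖ ^ 2) P := fun n =>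
    (hS n).norm.integrable_sq
  refine submartingale_of_setIntegral_le_succ (fun n => ((hadp n).norm.pow 2)) hint ?_
  intro n s hs
  have hs' : MeasurableSet s := (Filtration.natural ξ hξ).le n s hs
  set S : Ω → H := fun ω => ∑ i ∈ Finset.range (n + 1), ξ i ω with hSdef
  have hXm : StronglyMeasurable[Filtration.natural ξ hξ n] (s.indicator S) :=
    (hadp n).indicator hs
  have hX2 : MemLp (s.indicator S) 2 P := (hS n).indicator hs'
  have hXY : IndepFun (s.indicator S) (ξ (n + 1)) P := by
    rw [IndepFun_iff_Indep]
    exact indep_of_indep_of_le_left (hindep.indep_comap_natural_of_lt hξ (Nat.lt_succ_self n)).symm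
      hXm.measurable.comap_le
  have hzero := hXY.integral_inner_eq_zero (hX2.integrable (by norm_num))
    ((hL2 (n + 1)).integrable (by norm_num)) (hmean _)
  have hzero' : ∫ ω in s, inner ℝ (S ω) (ξ (n + 1) ω) ∂P = 0 := by
    rw [← hzero, ← integral_indicator hs']
    refine integral_congr_ae (Eventually.of_forall fun ω => ?_)
    by_cases hω : ω ∈ s <;> simp [hω]
  have hI : Integrable (fun ω => inner ℝ (S ω) (ξ (n + 1) ω)) P := (hS n).integrable_inner (hL2 _)
  calc ∫ ω in s, ‖S ω‖ ^ 2 ∂P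
      = ∫ ω in s, (‖S ω‖ ^ 2 + 2 * inner ℝ (S ω) (ξ (n + 1) ω)) ∂P := by
        rw [integral_add (hint n).integrableOn (hI.const_mul 2).integrableOn, integral_const_mul,
          hzero', mul_zero, add_zero]
    _ ≤ ∫ ω in s, ‖∑ i ∈ Finset.range (n + 1 + 1), ξ i ω‖ ^ 2 ∂P := by
        refine integral_mono ((hint n).add (hI.const_mul 2)).integrableOn
          (hint (n + 1)).integrableOn fun ω => ?_
        simp only
        rw [Finset.sum_range_succ _ (n + 1), norm_add_sq_real]
        have : 0 ≤ ‖ξ (n + 1) ω‖ ^ 2 := by positivity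
        linarith

variable [SecondCountableTopology H]

lemma integral_norm_sq_sum [IsProbabilityMeasure P] (hξ : ∀ i, StronglyMeasurable (ξ i))
    (hindep : iIndepFun ξ P) (hL2 : ∀ i, MemLp (ξ i) 2 P) (hmean : ∀ i, ∫ ω, ξ i ω ∂P = 0)
    (n : ℕ) : ∫ ω, ‖∑ i ∈ Finset.range n, ξ i ω‖ ^ 2 ∂P =
      ∑ i ∈ Finset.range n, ∫ ω, ‖ξ i ω‖ ^ 2 ∂P := by
  induction n with
  | zero => simp
  | succ n ih =>
    have hS : MemLp (fun ω => ∑ i ∈ Finset.range n, ξ i ω) 2 P :=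
      memLp_finsetSum _ fun i _ => hL2 i
    have hXY : IndepFun (fun ω => ∑ i ∈ Finset.range n, ξ i ω) (ξ n) P := by
      have h := hindep.indepFun_finsetSum_of_notMem (fun i => (hξ i).measurable)
        (s := Finset.range n) (i := n) (by simp)
      convert h using 1
      ext ω
      simp
    have hzero := hXY.integral_inner_eq_zero (hS.integrable (by norm_num))
      ((hL2 n).integrable (by norm_num)) (hmean _)
    simp_rw [Finset.sum_range_succ, norm_add_sq_real]
    have hI := hS.integrable_inner (hL2 n)
    have hI' : Integrable (fun ω => ‖∑ i ∈ Finset.range n, ξ i ω‖ ^ 2 +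
        2 * inner ℝ (∑ i ∈ Finset.range n, ξ i ω) (ξ n ω)) P :=
      hS.norm.integrable_sq.add (hI.const_mul 2)
    rw [integral_add hI' (hL2 n).norm.integrable_sq,
      integral_add hS.norm.integrable_sq (hI.const_mul 2), integral_const_mul, hzero, ih]
    ring

/-- **Kolmogorov's maximal inequality** in a Hilbert space. -/
theorem measure_exists_le_norm_sum_le [IsProbabilityMeasure P]
    (hξ : ∀ i, StronglyMeasurable (ξ i))
    (hindep : iIndepFun ξ P) (hL2 : ∀ i, MemLp (ξ i) 2 P) (hmean : ∀ i, ∫ ω, ξ i ω ∂P = 0)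
    (n : ℕ) {r : ℝ} (hr : 0 < r) :
    P {ω | ∃ m ≤ n, r ≤ ‖∑ i ∈ Finset.range m, ξ i ω‖} ≤
      ENNReal.ofReal ((∑ i ∈ Finset.range n, ∫ ω, ‖ξ i ω‖ ^ 2 ∂P) / r ^ 2) := by
  rcases n with _ | n
  · have : {ω | ∃ m ≤ 0, r ≤ ‖∑ i ∈ Finset.range m, ξ i ω‖} = ∅ := by
      ext ω
      simp [hr]
    rw [this]
    simp
  have hsub := submartingale_norm_sq_sum hξ hindep hL2 hmean
  -- Doob's maximal inequality for the squared norms at level `r²`; the empty sum, which this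
  -- submartingale omits, cannot reach `r > 0`.
  have hmax := maximal_ineq hsub (fun n ω => by positivity) (ε := (r ^ 2).toNNReal) n
  have hr2 : (((r ^ 2).toNNReal : ℝ≥0) : ℝ) = r ^ 2 := Real.coe_toNNReal _ (by positivity)
  rw [hr2] at hmax
  set A := {ω | r ^ 2 ≤ (Finset.range (n + 1)).sup' Finset.nonempty_range_add_one
    fun k => ‖∑ i ∈ Finset.range (k + 1), ξ i ω‖ ^ 2} with hA
  have hincl : {ω | ∃ m ≤ n + 1, r ≤ ‖∑ i ∈ Finset.range m, ξ i ω‖} ⊆ A := by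
    rintro ω ⟨m, hm, h⟩
    rcases m with _ | m
    · simp only [Finset.range_zero, Finset.sum_empty, norm_zero] at h
      linarith
    · rw [hA, Set.mem_ofPred_eq, Finset.le_sup'_iff]
      exact ⟨m, Finset.mem_range.2 (by omega), pow_le_pow_left₀ hr.le h 2⟩
  have hint : Integrable (fun ω => ‖∑ i ∈ Finset.range (n + 1), ξ i ω‖ ^ 2) P :=
    (hsub.integrable n)
  have h1 : ∫ ω in A, ‖∑ i ∈ Finset.range (n + 1), ξ i ω‖ ^ 2 ∂P ≤
      ∑ i ∈ Finset.range (n + 1), ∫ ω, ‖ξ i ω‖ ^ 2 ∂P := by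
    rw [← integral_norm_sq_sum hξ hindep hL2 hmean]
    exact setIntegral_le_integral hint (Eventually.of_forall fun ω => by positivity)
  refine (measure_mono hincl).trans ?_
  rw [ENNReal.ofReal_div_of_pos (by positivity), ENNReal.le_div_iff_mul_le (by simp [hr.ne']) (by simp)]
  rw [mul_comm]
  exact hmax.trans (ENNReal.ofReal_le_ofReal h1)

/-- Abel summation: control of all partial sums with the decreasing weights `1 / (i + 1 + D)` gives
control of the unweighted sum, with a factor linear in its length. -/
lemma sum_eq_abel_weighted {M : Type*} [AddCommGroup M] [Module ℝ M] (x : ℕ → M) {D : ℝ}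
    (hD : 0 < D) (n : ℕ) :
    ∑ i ∈ Finset.range n, x i =
      ((n : ℝ) + D) • ∑ i ∈ Finset.range n, ((i : ℝ) + 1 + D)⁻¹ • x i -
        ∑ j ∈ Finset.range n, ∑ i ∈ Finset.range j, ((i : ℝ) + 1 + D)⁻¹ • x i := by
  induction n with
  | zero => simp
  | succ n ih =>
    rw [Finset.sum_range_succ, ih, Finset.sum_range_succ _ n, Finset.sum_range_succ _ n]
    have h : ((n : ℝ) + 1 + D) • ((n : ℝ) + 1 + D)⁻¹ • x n = x n := by
      rw [smul_smul, mul_inv_cancel₀ (by positivity), one_smul]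
    rw [smul_add]
    push_cast
    rw [h]
    module

lemma sum_inv_sq_le {D : ℝ} (hD : 0 < D) (n : ℕ) :
    ∑ i ∈ Finset.range n, (((i : ℝ) + 1 + D)⁻¹) ^ 2 ≤ 1 / D := by
  -- The subtracted term makes the induction close: each square is at most a difference of
  -- consecutive reciprocals.
  have h : ∑ i ∈ Finset.range n, (((i : ℝ) + 1 + D)⁻¹) ^ 2 ≤ 1 / D - 1 / (n + D) := by
    induction n with
    | zero => simp
    | succ n ih =>
      rw [Finset.sum_range_succ]
      have : (((n : ℝ) + 1 + D)⁻¹) ^ 2 ≤ 1 / (n + D) - 1 / ((n + 1 : ℕ) + D) := by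
        have h1 : 0 < (n : ℝ) + D := by positivity
        rw [div_sub_div _ _ h1.ne' (by positivity), inv_pow, inv_eq_one_div,
          div_le_div_iff₀ (by positivity) (by positivity)]
        push_cast
        nlinarith
      linarith
  have : 0 < 1 / ((n : ℝ) + D) := by positivity
  linarith

/-- A **Hájek–Rényi inequality** for averages of independent centred Hilbert space valued random
variables with bounded second moments. -/
theorem measure_exists_le_norm_average_le [IsProbabilityMeasure P]
    (hξ : ∀ i, StronglyMeasurable (ξ i))
    (hindep : iIndepFun ξ P) (hL2 : ∀ i, MemLp (ξ i) 2 P) (hmean : ∀ i, ∫ ω, ξ i ω ∂P = 0)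
    {v : ℝ} (hv : ∀ i, ∫ ω, ‖ξ i ω‖ ^ 2 ∂P ≤ v)
    (n : ℕ) {r D : ℝ} (hr : 0 < r) (hD : 0 < D) :
    P {ω | ∃ m ≤ n, D ≤ m ∧ r * m ≤ ‖∑ i ∈ Finset.range m, ξ i ω‖} ≤
      ENNReal.ofReal (9 * v / (r ^ 2 * D)) := by
  -- If all weighted partial sums stay below `r / 3`, then Abel summation bounds the plain sum of `m
  -- ≥ D` terms by less than `((m + D) + m) * r / 3 ≤ r * m`. Hence the `3` here and the `9` in the
  -- bound.
  have h := measure_exists_le_norm_sum_le (P := P)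
    (ξ := fun i ω => ((i : ℝ) + 1 + D)⁻¹ • ξ i ω)
    (fun i => (hξ i).const_smul _)
    (hindep.comp (fun i x => ((i : ℝ) + 1 + D)⁻¹ • x) fun i => measurable_const_smul _)
    (fun i => (hL2 i).const_smul _)
    (fun i => by rw [integral_smul, hmean, smul_zero]) n (r := r / 3) (by positivity)
  refine (measure_mono ?_).trans (h.trans (ENNReal.ofReal_le_ofReal ?_))
  · rintro ω ⟨m, hm, hDm, hω⟩
    by_contra hcon
    simp only [Set.mem_ofPred_eq, not_exists, not_and, not_le] at hcon
    have hm0 : (0 : ℝ) < m := hD.trans_le hDm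
    rw [sum_eq_abel_weighted (fun i => ξ i ω) hD m] at hω
    have h1 := norm_sub_le (((m : ℝ) + D) • ∑ i ∈ Finset.range m, ((i : ℝ) + 1 + D)⁻¹ • ξ i ω)
      (∑ j ∈ Finset.range m, ∑ i ∈ Finset.range j, ((i : ℝ) + 1 + D)⁻¹ • ξ i ω)
    rw [norm_smul, Real.norm_of_nonneg (by positivity)] at h1
    have h2 : ‖∑ j ∈ Finset.range m, ∑ i ∈ Finset.range j, ((i : ℝ) + 1 + D)⁻¹ • ξ i ω‖ ≤
        m * (r / 3) := by
      refine (norm_sum_le _ _).trans ?_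
      have := Finset.sum_le_card_nsmul (Finset.range m)
        (fun j => ‖∑ i ∈ Finset.range j, ((i : ℝ) + 1 + D)⁻¹ • ξ i ω‖) (r / 3)
        fun j hj => (hcon j ((Finset.mem_range.1 hj).le.trans hm)).le
      simpa using this
    have h3 := mul_lt_mul_of_pos_left (hcon m hm) (by positivity : (0 : ℝ) < m + D)
    nlinarith
  · have h4 : ∀ i : ℕ, ∫ ω, ‖((i : ℝ) + 1 + D)⁻¹ • ξ i ω‖ ^ 2 ∂P ≤ (((i : ℝ) + 1 + D)⁻¹) ^ 2 * v := by
      intro i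
      simp_rw [norm_smul, mul_pow]
      rw [integral_const_mul, Real.norm_of_nonneg (by positivity)]
      gcongr
      exact hv i
    have hv0 : 0 ≤ v := le_trans (integral_nonneg fun ω => by positivity) (hv 0)
    have h5 : ∑ i ∈ Finset.range n, ∫ ω, ‖((i : ℝ) + 1 + D)⁻¹ • ξ i ω‖ ^ 2 ∂P ≤ 1 / D * v := by
      refine (Finset.sum_le_sum fun i _ => h4 i).trans ?_
      rw [← Finset.sum_mul]
      exact mul_le_mul_of_nonneg_right (sum_inv_sq_le hD n) hv0
    calc _ ≤ (1 / D * v) / (r / 3) ^ 2 := by gcongr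
      _ = _ := by
        field_simp
        ring

end MaximalInequality

/-! ### Localization of the argmax for independent noisy observations. -/

section CusumArgmax

/-- Reading the observations backwards from the change turns sums over `(k - m, k]` into initial
partial sums, to which the maximal inequality applies. The branch `j + 1` for `j ≥ k` only keeps the
reindexing injective on `ℕ`, so that independence survives. -/
lemma sum_range_reflect_reindex {M : Type*} [AddCommGroup M] (x : ℕ → M) (k : ℕ) {m : ℕ}
    (hm : m ≤ k) :
    ∑ j ∈ Finset.range m, x (if j < k then k - j else j + 1) =
      ∑ i ∈ Finset.Icc 1 k, x i - ∑ i ∈ Finset.Icc 1 (k - m), x i := by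
  induction m with
  | zero => simp
  | succ m ih =>
    rw [Finset.sum_range_succ, ih (by omega), if_pos (by omega),
      show k - m = k - (m + 1) + 1 by omega, Finset.sum_Icc_succ_top (by omega)]
    abel

lemma sum_range_shift {M : Type*} [AddCommGroup M] (x : ℕ → M) (k m : ℕ) :
    ∑ j ∈ Finset.range m, x (k + 1 + j) =
      ∑ i ∈ Finset.Icc 1 (k + m), x i - ∑ i ∈ Finset.Icc 1 k, x i := by
  induction m with
  | zero => simp
  | succ m ih =>
    rw [Finset.sum_range_succ, ih, ← add_assoc, Finset.sum_Icc_succ_top (by omega),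
      show k + 1 + m = k + m + 1 by omega]
    abel

lemma injective_reflect_reindex (k : ℕ) :
    Function.Injective fun j => if j < k then k - j else j + 1 := by
  intro i j hij
  dsimp only at hij
  split_ifs at hij <;> omega

variable {Ω : Type*} [MeasurableSpace Ω] {P : Measure Ω} [IsProbabilityMeasure P]
  {H : Type*} [NormedAddCommGroup H] [InnerProductSpace ℝ H] [CompleteSpace H]
  [MeasurableSpace H] [BorelSpace H] [SecondCountableTopology H]

/-- The probability that the norm of the CUSUM vector of independent observations, whose means are
close to a step function with a jump at `k`, is at least as large at some point at distance at
least `D` from `k` as it is at `k`. -/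
theorem measure_exists_norm_cusumVec_ge_le {X : ℕ → Ω → H} (hX : ∀ i, StronglyMeasurable (X i))
    (hindep : iIndepFun X P) (hL2 : ∀ i, MemLp (X i) 2 P) {f₁ f₂ : H} {k N : ℕ} {β v c D : ℝ}
    (hδ : f₁ ≠ f₂) (hc : 0 < c) (hN : 0 < N) (hk1 : c * N ≤ k) (hk2 : (k : ℝ) ≤ (1 - c) * N)
    (hD : 0 < D)
    (hbias : ∀ i, ‖∫ ω, X i ω ∂P - (if i ≤ k then f₁ else f₂)‖ ≤ β)
    (hβ : β ≤ c ^ 2 / 32 * ‖f₁ - f₂‖)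
    (hvar : ∀ i, ∫ ω, ‖X i ω - ∫ ω', X i ω' ∂P‖ ^ 2 ∂P ≤ v) :
    P {ω | ∃ n ≤ N, D ≤ |(n : ℝ) - k| ∧
        ‖cusumVec (fun i => X i ω) N k‖ ≤ ‖cusumVec (fun i => X i ω) N n‖} ≤
      ENNReal.ofReal (v / ((c ^ 2 / 32 * ‖f₁ - f₂‖) ^ 2 * N)) +
        2 * ENNReal.ofReal (9 * v / ((c ^ 2 / 32 * ‖f₁ - f₂‖) ^ 2 * D)) := by
  have hN' : (0 : ℝ) < N := by exact_mod_cast hN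
  have hδ' : 0 < ‖f₁ - f₂‖ := norm_pos_iff.2 (sub_ne_zero.2 hδ)
  set r := c ^ 2 / 32 * ‖f₁ - f₂‖ with hr
  have hr0 : 0 < r := by positivity
  set m : ℕ → H := fun i => ∫ ω, X i ω ∂P with hm
  set ε : ℕ → Ω → H := fun i ω => X i ω - m i with hε
  set b : ℕ → H := fun i => m i - (if i ≤ k then f₁ else f₂) with hb
  have hεmeas : ∀ i, StronglyMeasurable (ε i) := fun i => (hX i).sub stronglyMeasurable_const
  have hεindep : iIndepFun ε P := hindep.comp (fun i x => x - m i)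
    fun i => measurable_id.sub_const _
  have hεL2 : ∀ i, MemLp (ε i) 2 P := fun i => (hL2 i).sub (memLp_const _)
  have hεmean : ∀ i, ∫ ω, ε i ω ∂P = 0 := by
    intro i
    simp only [hε]
    rw [integral_sub ((hL2 i).integrable (by norm_num)) (integrable_const _)]
    simp [hm]
  -- The three exceptional events: a large partial sum of the whole sample (Kolmogorov), and a large
  -- average over a stretch of length at least `D` to the right or to the left of the change
  -- (Hájek–Rényi).
  set A₁ := {ω | ∃ n ≤ N, r * N ≤ ‖∑ i ∈ Finset.range n, ε (i + 1) ω‖}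
  set A₂ := {ω | ∃ n ≤ N, D ≤ n ∧ r * n ≤ ‖∑ i ∈ Finset.range n, ε (k + 1 + i) ω‖}
  set A₃ := {ω | ∃ n ≤ N, D ≤ n ∧
    r * n ≤ ‖∑ i ∈ Finset.range n, ε (if i < k then k - i else i + 1) ω‖}
  have h₁ : P A₁ ≤ ENNReal.ofReal (v / (r ^ 2 * N)) := by
    refine (measure_exists_le_norm_sum_le (fun i => hεmeas (i + 1))
      (hεindep.precomp (add_left_injective 1)) (fun i => hεL2 (i + 1)) (fun i => hεmean (i + 1)) N
      (by positivity)).trans (ENNReal.ofReal_le_ofReal ?_)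
    have h1 : ∑ i ∈ Finset.range N, ∫ ω, ‖ε (i + 1) ω‖ ^ 2 ∂P ≤ N * v := by
      have := Finset.sum_le_card_nsmul (Finset.range N) (fun i => ∫ ω, ‖ε (i + 1) ω‖ ^ 2 ∂P) v
        fun i _ => hvar (i + 1)
      simpa using this
    calc _ ≤ (N * v) / (r * N) ^ 2 := by gcongr
      _ = _ := by field_simp
  have h₂ : P A₂ ≤ ENNReal.ofReal (9 * v / (r ^ 2 * D)) :=
    measure_exists_le_norm_average_le (fun i => hεmeas (k + 1 + i))
      (hεindep.precomp (add_right_injective (k + 1))) (fun i => hεL2 _) (fun i => hεmean _)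
      (fun i => hvar _) N hr0 hD
  have h₃ : P A₃ ≤ ENNReal.ofReal (9 * v / (r ^ 2 * D)) :=
    measure_exists_le_norm_average_le (fun i => hεmeas (if i < k then k - i else i + 1))
      (hεindep.precomp (injective_reflect_reindex k)) (fun i => hεL2 _) (fun i => hεmean _)
      (fun i => hvar _) N hr0 hD
  refine (measure_mono (t := A₁ ∪ (A₂ ∪ A₃)) ?_).trans ((measure_union_le _ _).trans
    (add_le_add h₁ ((measure_union_le _ _).trans ?_)))
  swap
  · rw [two_mul]
    exact add_le_add h₂ h₃
  rintro ω ⟨n, hn, hDn, hω⟩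
  by_contra hcon
  simp only [Set.mem_union, not_or] at hcon
  obtain ⟨hω₁, hω₂, hω₃⟩ := hcon
  simp only [A₁, A₂, A₃, Set.mem_ofPred_eq, not_exists, not_and, not_le] at hω₁ hω₂ hω₃
  have hnk : n ≠ k := by
    rintro rfl
    simp only [sub_self, abs_zero] at hDn
    linarith
  have hXdec : (fun i => X i ω) = fun i => (if i ≤ k then f₁ else f₂) + (b i + ε i ω) := by
    ext i
    simp only [hb, hε]
    abel
  have hβ0 : 0 ≤ β := (norm_nonneg _).trans (hbias 0)
  have hkN : k ≤ N := by
    have : (k : ℝ) ≤ N := by nlinarith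
    exact_mod_cast this
  rw [hXdec] at hω
  -- Outside the exceptional events the deterministic comparison applies with perturbation `b + ε`.
  -- Its budget `c² / 16 * ‖f₁ - f₂‖` per observation is `2 r`: one `r` for the bias, one for the
  -- noise.
  refine absurd hω (not_le.2 (norm_cusumVec_lt hδ hc hN hk1 hk2 hn hnk ?_ ?_))
  · intro j hj
    rw [Finset.sum_add_distrib]
    have h1 : ‖∑ i ∈ Finset.Icc 1 j, b i‖ ≤ r * N := by
      have := Finset.sum_le_card_nsmul (Finset.Icc 1 j) (fun i => ‖b i‖) r
        fun i _ => (hbias i).trans hβ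
      refine (norm_sum_le _ _).trans (this.trans ?_)
      simp only [Nat.card_Icc, Nat.add_sub_cancel, nsmul_eq_mul]
      rw [mul_comm]
      gcongr
    have h2 := hω₁ j hj
    have e := sum_range_shift (fun i => ε i ω) 0 j
    simp only [zero_add, Finset.Icc_eq_empty_of_lt Nat.zero_lt_one, Finset.sum_empty,
      sub_zero] at e
    have h3 : ∑ i ∈ Finset.range j, ε (i + 1) ω = ∑ i ∈ Finset.Icc 1 j, ε i ω := by
      rw [← e]
      exact Finset.sum_congr rfl fun i _ => by rw [add_comm]
    rw [h3] at h2
    have h4 := norm_add_le (∑ i ∈ Finset.Icc 1 j, b i) (∑ i ∈ Finset.Icc 1 j, ε i ω)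
    have h5 : c ^ 2 / 16 * N * ‖f₁ - f₂‖ = r * N + r * N := by
      rw [hr]
      ring
    linarith
  · have h5 : c ^ 2 / 16 * |(n : ℝ) - k| * ‖f₁ - f₂‖ =
        |(n : ℝ) - k| * r + r * |(n : ℝ) - k| := by
      rw [hr]
      ring
    have hbsum : ∀ (s : ℕ → ℕ) (l : ℕ), ‖∑ i ∈ Finset.range l, b (s i)‖ ≤ l * r := by
      intro s l
      have := Finset.sum_le_card_nsmul (Finset.range l) (fun i => ‖b (s i)‖) r
        fun i _ => (hbias (s i)).trans hβ
      refine (norm_sum_le _ _).trans (this.trans ?_)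
      simp
    rw [h5]
    rcases lt_or_gt_of_ne hnk with h | h
    · obtain ⟨l, hl⟩ := Nat.exists_eq_add_of_lt h
      have hcast : |(n : ℝ) - k| = ((l + 1 : ℕ) : ℝ) := by
        rw [hl, abs_sub_comm, abs_of_nonneg (by push_cast; linarith [Nat.cast_nonneg (α := ℝ) l])]
        push_cast
        ring
      have e := sum_range_reflect_reindex (fun i => b i + ε i ω) k (m := l + 1) (by omega)
      rw [show k - (l + 1) = n by omega] at e
      rw [norm_sub_rev, ← e, hcast, Finset.sum_add_distrib]
      rw [hcast] at hDn
      exact (norm_add_le _ _).trans (add_le_add (hbsum _ _) (hω₃ (l + 1) (by omega) hDn).le)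
    · obtain ⟨l, hl⟩ := Nat.exists_eq_add_of_lt h
      have hcast : |(n : ℝ) - k| = ((l + 1 : ℕ) : ℝ) := by
        rw [hl, abs_of_nonneg (by push_cast; linarith [Nat.cast_nonneg (α := ℝ) l])]
        push_cast
        ring
      have e := sum_range_shift (fun i => b i + ε i ω) k (l + 1)
      rw [show k + (l + 1) = n by omega] at e
      rw [← e, hcast, Finset.sum_add_distrib]
      rw [hcast] at hDn
      exact (norm_add_le _ _).trans (add_le_add (hbsum _ _) (hω₂ (l + 1) (by omega) hDn).le)

end CusumArgmax

/-! ### Bias and mean squared error of a quotient. -/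

section Ratio

lemma div_mem_Icc_of_le {x y : ℝ} (hx : 0 ≤ x) (hxy : x ≤ y) : x / y ∈ Set.Icc (0 : ℝ) 1 :=
  ⟨div_nonneg hx (hx.trans hxy), div_le_one_of_le₀ hxy (hx.trans hxy)⟩

lemma abs_sub_le_one_of_mem_Icc {x y : ℝ} (hx : x ∈ Set.Icc (0 : ℝ) 1)
    (hy : y ∈ Set.Icc (0 : ℝ) 1) : |x - y| ≤ 1 := by
  rw [abs_le]
  constructor <;> linarith [hx.1, hx.2, hy.1, hy.2]

lemma one_le_four_mul_sq_div {y τ : ℝ} (hτ : 0 < τ) (h : y < τ / 2) :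
    1 ≤ 4 * (y - τ) ^ 2 / τ ^ 2 := by
  rw [one_le_div (by positivity)]
  nlinarith

/-- If `y ≥ τ / 2`, the denominator of `x / y - f = (x - f y) / y` is harmless. Otherwise the left
side is at most `1`, and the deviation of `y` from `τ` pays for it. -/
lemma sq_div_sub_le {x y τ f : ℝ} (hx : 0 ≤ x) (hxy : x ≤ y) (hτ : 0 < τ)
    (hf : f ∈ Set.Icc (0 : ℝ) 1) :
    (x / y - f) ^ 2 ≤ 4 * (x - f * y) ^ 2 / τ ^ 2 + 4 * (y - τ) ^ 2 / τ ^ 2 := by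
  rcases le_or_gt (τ / 2) y with h | h
  · have hy : 0 < y := by linarith
    have e : x / y - f = (x - f * y) / y := by field_simp
    have h1 : (x / y - f) ^ 2 ≤ 4 * (x - f * y) ^ 2 / τ ^ 2 := by
      rw [e, div_pow, div_le_div_iff₀ (by positivity) (by positivity)]
      have : τ ^ 2 ≤ 4 * y ^ 2 := by nlinarith
      nlinarith [sq_nonneg (x - f * y)]
    have : 0 ≤ 4 * (y - τ) ^ 2 / τ ^ 2 := by positivity
    linarith
  · have h1 := one_le_four_mul_sq_div hτ h
    have h2 : (x / y - f) ^ 2 ≤ 1 := by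
      have := abs_sub_le_one_of_mem_Icc (div_mem_Icc_of_le hx hxy) hf
      rw [← sq_abs]
      exact pow_le_one₀ (abs_nonneg _) this
    have : 0 ≤ 4 * (x - f * y) ^ 2 / τ ^ 2 := by positivity
    linarith

/-- The subtracted term is the linearization of the quotient, centred in the application. What
remains is quadratic in the deviations, so the bias is of the order of a variance. -/
lemma abs_div_sub_sub_le {x y τ f : ℝ} (hx : 0 ≤ x) (hxy : x ≤ y) (hτ : 0 < τ)
    (hf : f ∈ Set.Icc (0 : ℝ) 1) :
    |x / y - f - (x - f * y) / τ| ≤ (x - f * y) ^ 2 / τ ^ 2 + 4 * (y - τ) ^ 2 / τ ^ 2 := by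
  have h0 : 0 ≤ (x - f * y) ^ 2 / τ ^ 2 := by positivity
  rcases le_or_gt (τ / 2) y with h | h
  · have hy : 0 < y := by linarith
    have e : x / y - f - (x - f * y) / τ = (x - f * y) * (τ - y) / (y * τ) := by field_simp
    rw [e, abs_div, abs_mul, abs_of_pos (show 0 < y * τ by positivity), ← add_div,
      div_le_div_iff₀ (by positivity) (by positivity)]
    have h1 : 2 * (|x - f * y| * |τ - y|) ≤ (x - f * y) ^ 2 + 4 * (y - τ) ^ 2 := by
      have h2 : (y - τ) ^ 2 = |τ - y| ^ 2 := by rw [sq_abs]; ring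
      rw [h2, ← sq_abs (x - f * y)]
      nlinarith [sq_nonneg (|x - f * y| - |τ - y|), sq_nonneg (|τ - y|)]
    have h3 : τ ^ 2 ≤ 2 * (y * τ) := by nlinarith
    have h4 : 0 ≤ |x - f * y| * |τ - y| := by positivity
    calc |x - f * y| * |τ - y| * τ ^ 2 ≤ |x - f * y| * |τ - y| * (2 * (y * τ)) := by gcongr
      _ = 2 * (|x - f * y| * |τ - y|) * (y * τ) := by ring
      _ ≤ _ := by gcongr
  · have h1 := one_le_four_mul_sq_div hτ h
    have h2 : |x / y - f - (x - f * y) / τ| ≤ 1 := by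
      have hy := hx.trans hxy
      -- For small `y` the remainder factors into two terms of size at most `1`. The case `y = 0` is
      -- separate because there `x / y` has the value `0`.
      have e : x / y - f - (x - f * y) / τ = (x / y - f) * (1 - y / τ) - 0 ∨ y = 0 := by
        rcases eq_or_ne y 0 with h | h
        · exact Or.inr h
        · left
          field_simp
          ring
      have h3 := abs_sub_le_one_of_mem_Icc (div_mem_Icc_of_le hx hxy) hf
      rcases e with e | e
      · have h4 := div_mem_Icc_of_le hy (by linarith : y ≤ τ)
        rw [e, sub_zero, abs_mul, abs_of_nonneg (show 0 ≤ 1 - y / τ by linarith [h4.2])]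
        exact mul_le_one₀ h3 (by linarith [h4.2]) (by linarith [h4.1])
      · have hx0 : x = 0 := le_antisymm (e ▸ hxy) hx
        simpa [e, hx0] using h3
    linarith

variable {Ω : Type*} [MeasurableSpace Ω] {P : Measure Ω} [IsProbabilityMeasure P]

lemma integrable_div_of_le {A T : Ω → ℝ} (hA : AEStronglyMeasurable A P)
    (hT : AEStronglyMeasurable T P) (hA0 : ∀ ω, 0 ≤ A ω) (hAT : ∀ ω, A ω ≤ T ω) :
    Integrable (fun ω => A ω / T ω) P :=
  Integrable.of_mem_Icc 0 1 (hA.aemeasurable.div hT.aemeasurable)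
    (Eventually.of_forall fun ω => div_mem_Icc_of_le (hA0 ω) (hAT ω))

/-- Bias and mean squared error of a ratio of random variables with small variances. -/
theorem abs_integral_div_sub_le_and_integral_sq_le {A T : Ω → ℝ} (hA : MemLp A 2 P)
    (hT : MemLp T 2 P) (hA0 : ∀ ω, 0 ≤ A ω) (hAT : ∀ ω, A ω ≤ T ω) {α τ s : ℝ} (hτ : 0 < τ)
    (hAα : ∫ ω, A ω ∂P = α) (hTτ : ∫ ω, T ω ∂P = τ) (hAs : ∫ ω, (A ω - α) ^ 2 ∂P ≤ s)
    (hTs : ∫ ω, (T ω - τ) ^ 2 ∂P ≤ s) :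
    |∫ ω, A ω / T ω ∂P - α / τ| ≤ 8 * s / τ ^ 2 ∧
      ∫ ω, (A ω / T ω - α / τ) ^ 2 ∂P ≤ 20 * s / τ ^ 2 := by
  have hAi := hA.integrable one_le_two
  have hTi := hT.integrable one_le_two
  have hα : α / τ ∈ Set.Icc (0 : ℝ) 1 := by
    refine div_mem_Icc_of_le ?_ ?_
    · rw [← hAα]
      exact integral_nonneg hA0
    · rw [← hAα, ← hTτ]
      exact integral_mono hAi hTi hAT
  set f := α / τ with hf
  have hfα : f * τ = α := div_mul_cancel₀ _ hτ.ne'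
  have hR := integrable_div_of_le hA.1 hT.1 hA0 hAT
  have hZ2 : MemLp (fun ω => A ω - f * T ω) 2 P := hA.sub (hT.const_mul f)
  have hZi := hZ2.integrable one_le_two
  have hAc : Integrable (fun ω => (A ω - α) ^ 2) P := (hA.sub (memLp_const α)).integrable_sq
  have hTc : Integrable (fun ω => (T ω - τ) ^ 2) P := (hT.sub (memLp_const τ)).integrable_sq
  have hZ0 : ∫ ω, (A ω - f * T ω) ∂P = 0 := by
    rw [integral_sub hAi (hTi.const_mul f), integral_const_mul, hAα, hTτ, hfα, sub_self]
  -- Here `A - f T = (A - α) - f (T - τ)` with `0 ≤ f ≤ 1`. Together with the term `4 (T - τ)²` this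
  -- yields `8 = 4 + 4` and `20 = 4 * 4 + 4`.
  have hZs : ∫ ω, (A ω - f * T ω) ^ 2 ∂P ≤ 4 * s := by
    have h1 : ∫ ω, (A ω - f * T ω) ^ 2 ∂P ≤
        ∫ ω, (2 * (A ω - α) ^ 2 + 2 * (T ω - τ) ^ 2) ∂P := by
      refine integral_mono hZ2.integrable_sq ((hAc.const_mul 2).add (hTc.const_mul 2))
        fun ω => ?_
      simp only
      have e : A ω - f * T ω = (A ω - α) - f * (T ω - τ) := by rw [← hfα]; ring
      rw [e]
      have h2 : f ^ 2 * (T ω - τ) ^ 2 ≤ 1 * (T ω - τ) ^ 2 := by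
        gcongr
        exact pow_le_one₀ hα.1 hα.2
      nlinarith [sq_nonneg ((A ω - α) + f * (T ω - τ))]
    rw [integral_add (hAc.const_mul 2) (hTc.const_mul 2), integral_const_mul,
      integral_const_mul] at h1
    linarith
  have hZZ := hZ2.integrable_sq
  have hτ2 : 0 < τ ^ 2 := by positivity
  constructor
  · have e : ∫ ω, A ω / T ω ∂P - f =
        ∫ ω, (A ω / T ω - f - (A ω - f * T ω) / τ) ∂P := by
      have hRf : Integrable (fun ω => A ω / T ω - f) P := hR.sub (integrable_const f)
      rw [integral_sub hRf (hZi.div_const τ), integral_div, hZ0,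
        integral_sub hR (integrable_const f)]
      simp
    rw [e]
    have hbound : Integrable (fun ω => (A ω - f * T ω) ^ 2 / τ ^ 2 +
        4 * (T ω - τ) ^ 2 / τ ^ 2) P := (hZZ.div_const _).add ((hTc.const_mul 4).div_const _)
    refine abs_integral_le_integral_abs.trans ((integral_mono
      ((hR.sub (integrable_const f)).sub (hZi.div_const τ)).abs hbound
      fun ω => abs_div_sub_sub_le (hA0 ω) (hAT ω) hτ hα).trans ?_)
    rw [integral_add (hZZ.div_const _) ((hTc.const_mul 4).div_const _), integral_div,
      integral_div, integral_const_mul, ← add_div]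
    gcongr
    linarith
  · have hbound : Integrable (fun ω => 4 * (A ω - f * T ω) ^ 2 / τ ^ 2 +
        4 * (T ω - τ) ^ 2 / τ ^ 2) P :=
      ((hZZ.const_mul 4).div_const _).add ((hTc.const_mul 4).div_const _)
    refine (integral_mono_of_nonneg (Eventually.of_forall fun ω => sq_nonneg _) hbound
      (Eventually.of_forall fun ω => sq_div_sub_le (hA0 ω) (hAT ω) hτ hα)).trans ?_
    rw [integral_add ((hZZ.const_mul 4).div_const _) ((hTc.const_mul 4).div_const _),
      integral_div, integral_div, integral_const_mul, integral_const_mul, ← add_div]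
    gcongr
    linarith

end Ratio

/-! ### Sums of squares of Gaussian block sums. -/

section GaussianSums

variable {Ω : Type*} [MeasurableSpace Ω] {P : Measure Ω}

/-- Only the scaling in `v` matters; the standard fourth moment stays as an unevaluated constant
throughout. -/
lemma integral_pow_four_gaussianReal (v : ℝ≥0) :
    ∫ x, x ^ 4 ∂gaussianReal 0 v = (∫ x, x ^ 4 ∂gaussianReal 0 1) * v ^ 2 := by
  have h := gaussianReal_map_const_mul (μ := 0) (v := 1) (√(v : ℝ))
  have e : (⟨√(v : ℝ) ^ 2, sq_nonneg _⟩ : ℝ≥0) * 1 = v := by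
    ext
    simp
  rw [mul_zero] at h
  erw [e] at h
  rw [← h, integral_map (by fun_prop) (by fun_prop)]
  simp_rw [mul_pow]
  rw [integral_const_mul, show √(v : ℝ) ^ 4 = (√(v : ℝ) ^ 2) ^ 2 by ring, Real.sq_sqrt v.coe_nonneg,
    mul_comm]

lemma ProbabilityTheory.HasLaw.memLp_of_gaussianReal {X : Ω → ℝ} {v : ℝ≥0}
    (hX : HasLaw X (gaussianReal 0 v) P) (p : ℝ≥0) : MemLp X p P := by
  have := memLp_id_gaussianReal (μ := 0) (v := v) p
  rw [← hX.map_eq, memLp_map_measure_iff (by fun_prop) hX.aemeasurable] at this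
  exact this

lemma ProbabilityTheory.HasLaw.memLp_sq_of_gaussianReal {X : Ω → ℝ} {v : ℝ≥0}
    (hX : HasLaw X (gaussianReal 0 v) P) : MemLp (fun ω => X ω ^ 2) 2 P := by
  have h4 := hX.memLp_of_gaussianReal 4
  refine (memLp_two_iff_integrable_sq (f := fun ω => X ω ^ 2) (h4.1.pow 2)).2 ?_
  have := h4.integrable_norm_pow (by norm_num)
  refine this.congr (Eventually.of_forall fun ω => ?_)
  norm_num
  rw [← pow_mul]
  exact Even.pow_abs (by decide) _

lemma ProbabilityTheory.HasLaw.integral_sq_of_gaussianReal {X : Ω → ℝ} {v : ℝ≥0}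
    (hX : HasLaw X (gaussianReal 0 v) P) : ∫ ω, X ω ^ 2 ∂P = v := by
  have h := hX.variance_eq
  rw [variance_id_gaussianReal, variance_of_integral_eq_zero hX.aemeasurable] at h
  · exact h
  · rw [hX.integral_eq, integral_id_gaussianReal]

lemma ProbabilityTheory.HasLaw.variance_sq_le_of_gaussianReal [IsProbabilityMeasure P]
    {X : Ω → ℝ} {v : ℝ≥0}
    (hX : HasLaw X (gaussianReal 0 v) P) :
    Var[fun ω => X ω ^ 2; P] ≤ (∫ x, x ^ 4 ∂gaussianReal 0 1) * v ^ 2 := by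
  refine (variance_le_expectation_sq (hX.memLp_sq_of_gaussianReal).1).trans (le_of_eq ?_)
  rw [← integral_pow_four_gaussianReal, ← hX.integral_comp (f := fun x => x ^ 4) (by fun_prop)]
  refine integral_congr_ae (Eventually.of_forall fun ω => ?_)
  simp only [Pi.pow_apply, Function.comp_apply]
  ring

variable {D : ℕ → Ω → ℝ} {v : ℕ → ℝ≥0}

lemma hasLaw_sum_gaussianReal [IsProbabilityMeasure P] (hD : iIndepFun D P)
    (hlaw : ∀ j, HasLaw (D j) (gaussianReal 0 (v j)) P) (s : Finset ℕ) :
    HasLaw (fun ω => ∑ j ∈ s, D j ω) (gaussianReal 0 (∑ j ∈ s, v j)) P := by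
  classical
  induction s using Finset.induction_on with
  | empty =>
    simp only [Finset.sum_empty, gaussianReal_zero_var]
    exact hasLaw_dirac_of_ae_eq (Eventually.of_forall fun _ => rfl)
  | insert a s ha ih =>
    have hind := (hD.indepFun_finsetSum_of_notMem₀ (fun j => (hlaw j).aemeasurable) ha).symm
    have e : (∑ j ∈ s, D j) = fun ω => ∑ j ∈ s, D j ω := by
      ext ω
      simp
    rw [e] at hind
    have h := gaussianReal_add_gaussianReal_of_indepFun hind (hlaw a).map_eq ih.map_eq
    rw [add_zero, ← Finset.sum_insert ha] at h
    have e' : (D a + fun ω => ∑ j ∈ s, D j ω) = fun ω => ∑ j ∈ insert a s, D j ω := by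
      ext ω
      simp [Finset.sum_insert ha]
    rw [e'] at h
    exact ⟨Finset.aemeasurable_fun_sum _ fun j _ => (hlaw j).aemeasurable, h⟩

lemma indepFun_sum_sum_of_disjoint (hD : iIndepFun D P) (hmeas : ∀ j, AEMeasurable (D j) P)
    {s t : Finset ℕ} (hst : Disjoint s t) :
    IndepFun (fun ω => ∑ j ∈ s, D j ω) (fun ω => ∑ j ∈ t, D j ω) P := by
  have h := hD.indepFun_finset₀ s t hst hmeas
  have h' := h.comp (φ := fun x : s → ℝ => ∑ i, x i) (ψ := fun x : t → ℝ => ∑ i, x i)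
    (by fun_prop) (by fun_prop)
  convert h' using 1 <;>
  · ext ω
    simp only [Function.comp_apply]
    exact (Finset.sum_coe_sort _ fun j => D j ω).symm

/-- Mean and variance of the sum of squares of sums of independent Gaussian variables over disjoint
blocks. -/
lemma sum_sq_block_gaussian [IsProbabilityMeasure P] (hD : iIndepFun D P)
    (hlaw : ∀ j, HasLaw (D j) (gaussianReal 0 (v j)) P) (s : ℕ → Finset ℕ)
    (hs : Pairwise fun k l => Disjoint (s k) (s l)) (n : ℕ) {w : ℝ}
    (hw : ∀ k < n, ((∑ j ∈ s k, v j : ℝ≥0) : ℝ) ≤ w) :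
    MemLp (fun ω => ∑ k ∈ Finset.range n, (∑ j ∈ s k, D j ω) ^ 2) 2 P ∧
    ∫ ω, ∑ k ∈ Finset.range n, (∑ j ∈ s k, D j ω) ^ 2 ∂P =
      ∑ k ∈ Finset.range n, ∑ j ∈ s k, (v j : ℝ) ∧
    Var[fun ω => ∑ k ∈ Finset.range n, (∑ j ∈ s k, D j ω) ^ 2; P] ≤
      n * ((∫ x, x ^ 4 ∂gaussianReal 0 1) * w ^ 2) := by
  have hl := fun k => hasLaw_sum_gaussianReal hD hlaw (s k)
  have hm := fun k => (hl k).memLp_sq_of_gaussianReal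
  refine ⟨memLp_finsetSum _ fun k _ => hm k, ?_, ?_⟩
  · rw [integral_finsetSum _ fun k _ => (hm k).integrable one_le_two]
    refine Finset.sum_congr rfl fun k _ => ?_
    rw [(hl k).integral_sq_of_gaussianReal]
    push_cast
    rfl
  · have hv := IndepFun.variance_sum (μ := P) (s := Finset.range n)
      (X := fun k ω => (∑ j ∈ s k, D j ω) ^ 2) (fun k _ => hm k) fun k _ l _ hkl =>
        (indepFun_sum_sum_of_disjoint hD (fun j => (hlaw j).aemeasurable) (hs hkl)).comp
          (φ := fun x => x ^ 2) (ψ := fun x => x ^ 2) (by fun_prop) (by fun_prop)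
    have e : (∑ k ∈ Finset.range n, fun ω => (∑ j ∈ s k, D j ω) ^ 2) =
        fun ω => ∑ k ∈ Finset.range n, (∑ j ∈ s k, D j ω) ^ 2 := by
      ext ω
      simp
    rw [e] at hv
    rw [hv]
    have h4 : 0 ≤ ∫ x, x ^ 4 ∂gaussianReal 0 1 := integral_nonneg fun x => by positivity
    have := Finset.sum_le_card_nsmul (Finset.range n)
      (fun k => Var[fun ω => (∑ j ∈ s k, D j ω) ^ 2; P])
      ((∫ x, x ^ 4 ∂gaussianReal 0 1) * w ^ 2) fun k hk =>
        (hl k).variance_sq_le_of_gaussianReal.trans (by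
          have := hw k (Finset.mem_range.1 hk)
          gcongr)
    simpa using this

end GaussianSums

/-! ### Passing moments to the limit. -/

section Limits

variable {Ω : Type*} [MeasurableSpace Ω] {P : Measure Ω}

/-- Cauchy–Schwarz applied to `f² - g² = (f - g) (f - g + 2 g)`. -/
lemma tendsto_eLpNorm_sq_sub {f : ℕ → Ω → ℝ} {g : Ω → ℝ} (hf : ∀ p, MemLp (f p) 2 P)
    (hg : MemLp g 2 P) (h : Tendsto (fun p => eLpNorm (f p - g) 2 P) atTop (𝓝 0)) :
    Tendsto (fun p => eLpNorm ((fun ω => f p ω ^ 2) - fun ω => g ω ^ 2) 1 P) atTop (𝓝 0) := by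
  have hle : ∀ p, eLpNorm ((fun ω => f p ω ^ 2) - fun ω => g ω ^ 2) 1 P ≤
      eLpNorm (f p - g) 2 P * (eLpNorm (f p - g) 2 P + 2 * eLpNorm g 2 P) := by
    intro p
    have e : ((fun ω => f p ω ^ 2) - fun ω => g ω ^ 2) = (f p - g) • (f p - g + (g + g)) := by
      ext ω
      simp only [Pi.sub_apply, Pi.smul_apply', Pi.add_apply, smul_eq_mul]
      ring
    rw [e]
    have hd := (hf p).sub hg
    refine (eLpNorm_smul_le_mul_eLpNorm (p := 2) (q := 2) (hd.1.add (hg.1.add hg.1)) hd.1).trans ?_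
    gcongr
    refine (eLpNorm_add_le hd.1 (hg.1.add hg.1) one_le_two).trans ?_
    gcongr
    rw [two_mul]
    exact eLpNorm_add_le hg.1 hg.1 one_le_two
  refine tendsto_of_tendsto_of_tendsto_of_le_of_le tendsto_const_nhds ?_ (fun _ => zero_le) hle
  have h2 : Tendsto (fun p => eLpNorm (f p - g) 2 P + 2 * eLpNorm g 2 P) atTop
      (𝓝 (0 + 2 * eLpNorm g 2 P)) := h.add tendsto_const_nhds
  have := ENNReal.Tendsto.mul h (Or.inr (by
    rw [zero_add]
    exact ENNReal.mul_ne_top (by norm_num) hg.2.ne)) h2 (Or.inr (by norm_num))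
  simpa using this

/-- An `L¹`-limit of random variables with uniformly bounded variances. -/
lemma memLp_and_variance_le_of_tendsto_L1 [IsProbabilityMeasure P] {f : ℕ → Ω → ℝ} {g : Ω → ℝ}
    {s μ : ℝ}
    (hf : ∀ᶠ p in atTop, MemLp (f p) 2 P ∧ Var[f p; P] ≤ s) (hg : Integrable g P)
    (h : Tendsto (fun p => eLpNorm (f p - g) 1 P) atTop (𝓝 0))
    (hμ : Tendsto (fun p => ∫ ω, f p ω ∂P) atTop (𝓝 μ)) :
    MemLp g 2 P ∧ ∫ ω, g ω ∂P = μ ∧ ∫ ω, (g ω - μ) ^ 2 ∂P ≤ s := by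
  obtain ⟨p₀, hp₀⟩ := eventually_atTop.1 hf
  set f' : ℕ → Ω → ℝ := fun p => f (p + p₀) with hf'
  have hmem : ∀ p, MemLp (f' p) 2 P := fun p => (hp₀ _ (Nat.le_add_left _ _)).1
  have hvar : ∀ p, Var[f' p; P] ≤ s := fun p => (hp₀ _ (Nat.le_add_left _ _)).2
  have hlim : Tendsto (fun p => eLpNorm (f' p - g) 1 P) atTop (𝓝 0) :=
    h.comp (tendsto_add_atTop_nat p₀)
  have hμ' : Tendsto (fun p => ∫ ω, f' p ω ∂P) atTop (𝓝 μ) := hμ.comp (tendsto_add_atTop_nat p₀)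
  have hs0 : 0 ≤ s := (variance_nonneg _ _).trans (hvar 0)
  have hgμ : ∫ ω, g ω ∂P = μ := by
    have := tendsto_integral_of_L1' g hg.1
      (Eventually.of_forall fun p => (hmem p).integrable one_le_two) hlim
    exact tendsto_nhds_unique this hμ'
  -- Only `L¹` convergence is available, so the variance bound passes to the limit by Fatou, along
  -- an almost surely convergent subsequence of the centred variables.
  obtain ⟨φ, hφ, hae⟩ := (tendstoInMeasure_of_tendsto_eLpNorm one_ne_zero
    (fun p => (hmem p).1) hg.1 hlim).exists_seq_tendsto_ae
  have hcmem : ∀ p, MemLp (fun ω => f' p ω - ∫ ω', f' p ω' ∂P) 2 P := fun p =>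
    (hmem p).sub (memLp_const _)
  have hsq : ∀ {u : Ω → ℝ}, MemLp u 2 P → eLpNorm u 2 P =
      ENNReal.ofReal (√(∫ ω, u ω ^ 2 ∂P)) := by
    intro u hu
    rw [hu.eLpNorm_eq_integral_rpow_norm (by norm_num) (by norm_num), Real.sqrt_eq_rpow]
    simp
  have hbound : eLpNorm (fun ω => g ω - μ) 2 P ≤ ENNReal.ofReal (√s) := by
    refine Lp.eLpNorm_le_of_ae_tendsto (u := atTop)
      (f := fun i ω => f' (φ i) ω - ∫ ω', f' (φ i) ω' ∂P) (Eventually.of_forall fun i => ?_)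
      (fun i => (hcmem _).1) ?_
    · rw [hsq (hcmem _)]
      refine ENNReal.ofReal_le_ofReal (Real.sqrt_le_sqrt ?_)
      rw [← variance_eq_integral (hmem _).1.aemeasurable]
      exact hvar _
    · filter_upwards [hae] with ω hω
      exact hω.sub (hμ'.comp hφ.tendsto_atTop)
  have hc : MemLp (fun ω => g ω - μ) 2 P :=
    ⟨hg.1.sub aestronglyMeasurable_const, hbound.trans_lt ENNReal.ofReal_lt_top⟩
  refine ⟨?_, hgμ, ?_⟩
  · have := hc.add (memLp_const μ)
    refine this.ae_eq (Eventually.of_forall fun ω => ?_)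
    simp
  · rw [hsq hc, ENNReal.ofReal_le_ofReal_iff (Real.sqrt_nonneg _),
      Real.sqrt_le_sqrt_iff hs0] at hbound
    exact hbound

end Limits

/-! ### Riemann sums over uniform grids. -/

section RiemannSums

lemma intervalIntegrable_grid {f : ℝ → ℝ} {m : ℕ} (hm : 0 < m) {L : ℕ} (hL : L ≤ m)
    (hf : ContinuousOn f (Set.Icc 0 1)) {j : ℕ} (hj : j < L) :
    IntervalIntegrable f volume ((j : ℝ) / m) (((j + 1 : ℕ) : ℝ) / m) := by
  have hm' : (0 : ℝ) < m := by exact_mod_cast hm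
  have hjm : ((j + 1 : ℕ) : ℝ) ≤ m := by exact_mod_cast hj.trans_le hL
  refine ContinuousOn.intervalIntegrable (hf.mono ?_)
  rw [Set.uIcc_of_le (by gcongr; omega)]
  exact Set.Icc_subset_Icc (by positivity) (by rwa [div_le_one hm'])

/-- Closeness is required only inside the open cells, since grid points are null. With `ε = 0` this
integrates step functions exactly, whatever their values at the jumps. -/
lemma abs_integral_sub_sum_grid_le {f : ℝ → ℝ} {q : ℕ → ℝ} {m L : ℕ} {ε : ℝ} (hm : 0 < m)
    (hint : ∀ j < L, IntervalIntegrable f volume ((j : ℝ) / m) (((j + 1 : ℕ) : ℝ) / m))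
    (h : ∀ j < L, ∀ u ∈ Set.Ioo ((j : ℝ) / m) (((j + 1 : ℕ) : ℝ) / m), |f u - q j| ≤ ε) :
    |(∫ u in (0 : ℝ)..((L : ℝ) / m), f u) - ∑ j ∈ Finset.range L, q j / m| ≤ ε * (L / m) := by
  have hm' : (0 : ℝ) < m := by exact_mod_cast hm
  have hsum := intervalIntegral.sum_integral_adjacent_intervals (f := f) (μ := volume)
    (a := fun j : ℕ => (j : ℝ) / m) (n := L) hint
  simp only [Nat.cast_zero, zero_div] at hsum
  have hterm : ∀ j < L, |(∫ u in ((j : ℝ) / m)..(((j + 1 : ℕ) : ℝ) / m), f u) - q j / m| ≤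
      ε * (1 / m) := by
    intro j hj
    have hlen : ((j + 1 : ℕ) : ℝ) / m - (j : ℝ) / m = 1 / m := by
      push_cast
      ring
    have e : (∫ u in ((j : ℝ) / m)..(((j + 1 : ℕ) : ℝ) / m), f u) - q j / m =
        ∫ u in ((j : ℝ) / m)..(((j + 1 : ℕ) : ℝ) / m), (f u - q j) := by
      rw [intervalIntegral.integral_sub (hint j hj) intervalIntegrable_const,
        intervalIntegral.integral_const, hlen, smul_eq_mul]
      ring
    rw [e]
    have hb := intervalIntegral.norm_integral_le_of_norm_le_const_ae (a := (j : ℝ) / m)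
      (b := ((j + 1 : ℕ) : ℝ) / m) (C := ε) (f := fun u => f u - q j) ?_
    · rw [hlen, abs_of_pos (by positivity : (0 : ℝ) < 1 / m)] at hb
      exact hb
    · have hne : ∀ᵐ u : ℝ, u ≠ ((j + 1 : ℕ) : ℝ) / m := by
        simp [ae_iff]
      filter_upwards [hne] with u hu hmem
      rw [Set.uIoc_of_le (by gcongr; omega)] at hmem
      exact h j hj u ⟨hmem.1, lt_of_le_of_ne hmem.2 hu⟩
  rw [← hsum, ← Finset.sum_sub_distrib]
  refine (Finset.abs_sum_le_sum_abs _ _).trans ?_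
  have := Finset.sum_le_card_nsmul (Finset.range L)
    (fun j => |(∫ u in ((j : ℝ) / m)..(((j + 1 : ℕ) : ℝ) / m), f u) - q j / m|)
    (ε * (1 / m)) fun j hj => hterm j (Finset.mem_range.1 hj)
  refine this.trans (le_of_eq ?_)
  simp only [Finset.card_range, nsmul_eq_mul]
  ring

lemma tendsto_riemann_sum {f : ℝ → ℝ} (hf : ContinuousOn f (Set.Icc 0 1)) {K n : ℕ} (hK : 0 < K)
    (hn : n ≤ K) :
    Tendsto (fun p : ℕ => ∑ j ∈ Finset.range (n * p), f ((j : ℝ) / (K * p : ℕ)) / (K * p : ℕ))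
      atTop (𝓝 (∫ u in (0 : ℝ)..((n : ℝ) / K), f u)) := by
  have huc := (isCompact_Icc (a := (0 : ℝ)) (b := 1)).uniformContinuousOn_of_continuous hf
  rw [Metric.uniformContinuousOn_iff_le] at huc
  rw [Metric.tendsto_atTop]
  intro ε hε
  obtain ⟨δ, hδ, h⟩ := huc (ε / 2) (by positivity)
  obtain ⟨p₀, hp₀⟩ := exists_nat_one_div_lt hδ
  refine ⟨p₀ + 1, fun p hp => ?_⟩
  have hp' : 0 < p := by omega
  have hm : 0 < K * p := by positivity
  have hm' : (0 : ℝ) < (K * p : ℕ) := by exact_mod_cast hm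
  have hL : n * p ≤ K * p := Nat.mul_le_mul_right p hn
  have key := abs_integral_sub_sum_grid_le (f := f) (q := fun j => f ((j : ℝ) / (K * p : ℕ)))
    (L := n * p) (ε := ε / 2) hm (fun j hj => intervalIntegrable_grid hm hL hf hj) ?_
  · have e : ((n * p : ℕ) : ℝ) / (K * p : ℕ) = (n : ℝ) / K := by
      have : (p : ℝ) ≠ 0 := by positivity
      push_cast
      rw [mul_div_mul_right _ _ this]
    rw [e, abs_sub_comm] at key
    rw [Real.dist_eq]
    have h1 : (n : ℝ) / K ≤ 1 := by
      rw [div_le_one (by exact_mod_cast hK)]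
      exact_mod_cast hn
    have h2 : 0 ≤ (n : ℝ) / K := by positivity
    refine key.trans_lt ?_
    nlinarith
  · intro j hj u hu
    have hj1 : ((j + 1 : ℕ) : ℝ) / (K * p : ℕ) ≤ 1 := by
      rw [div_le_one hm']
      exact_mod_cast (show j + 1 ≤ K * p by omega)
    have hj0 : (0 : ℝ) ≤ (j : ℝ) / (K * p : ℕ) := by positivity
    have hlen : ((j + 1 : ℕ) : ℝ) / (K * p : ℕ) = (j : ℝ) / (K * p : ℕ) + 1 / (K * p : ℕ) := by
      push_cast
      ring
    have hpm : 1 / ((K * p : ℕ) : ℝ) ≤ 1 / ((p₀ : ℝ) + 1) := by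
      apply one_div_le_one_div_of_le (by positivity)
      have : p₀ + 1 ≤ K * p := hp.trans (Nat.le_mul_of_pos_left p hK)
      exact_mod_cast this
    have := h u ⟨hj0.trans hu.1.le, hu.2.le.trans hj1⟩ ((j : ℝ) / (K * p : ℕ))
      ⟨hj0, (hu.1.trans hu.2).le.trans hj1⟩ (by
        rw [Real.dist_eq, abs_of_pos (by linarith [hu.1])]
        linarith [hu.2])
    rwa [Real.dist_eq] at this

end RiemannSums

/-! ### Moments of squared increments of the Itô integral. -/

section ItoIncrements

variable {Ω : Type*} {W : ℝ≥0 → Ω → ℝ} {ν : ℝ → ℝ}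

/-- The sum of the squares of the first `n` increments of `Y` over the grid of mesh `1 / K`. -/
noncomputable def incrementSq (Y : ℝ → Ω → ℝ) (K n : ℕ) (ω : Ω) : ℝ :=
  ∑ k ∈ Finset.range n, (Y (((k + 1 : ℕ) : ℝ) / K) ω - Y ((k : ℝ) / K) ω) ^ 2

/-- The mesh `1 / (K p)` refines the grid, so the time `n / K` is a node: the truncation by `min`
leaves the first `n p` terms unchanged and kills all the others. -/
lemma elementaryItoIntegral_grid (W : ℝ≥0 → Ω → ℝ) (ν : ℝ → ℝ) {K n p : ℕ} (hK : 0 < K)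
    (hn : n ≤ K) (hp : 0 < p) (ω : Ω) :
    elementaryItoIntegral W ν (K * p) ((n : ℝ) / K) ω =
      ∑ j ∈ Finset.range (n * p), ν ((j : ℝ) / (K * p : ℕ)) *
        (W (((j + 1 : ℕ) : ℝ) / (K * p : ℕ)).toNNReal ω - W ((j : ℝ) / (K * p : ℕ)).toNNReal ω) := by
  have hm' : (0 : ℝ) < (K * p : ℕ) := by exact_mod_cast Nat.mul_pos hK hp
  have e : (n : ℝ) / K = ((n * p : ℕ) : ℝ) / (K * p : ℕ) := by
    have : (p : ℝ) ≠ 0 := by positivity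
    push_cast
    rw [mul_div_mul_right _ _ this]
  have hL : n * p ≤ K * p := Nat.mul_le_mul_right p hn
  unfold elementaryItoIntegral
  rw [← Finset.sum_range_add_sum_Ico _ hL, e]
  have h0 : ∑ j ∈ Finset.Ico (n * p) (K * p), ν ((j : ℝ) / (K * p : ℕ)) *
      (W (min (((j + 1 : ℕ) : ℝ) / (K * p : ℕ)) (((n * p : ℕ) : ℝ) / (K * p : ℕ))).toNNReal ω -
        W (min ((j : ℝ) / (K * p : ℕ)) (((n * p : ℕ) : ℝ) / (K * p : ℕ))).toNNReal ω) = 0 := by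
    refine Finset.sum_eq_zero fun j hj => ?_
    have hj' := (Finset.mem_Ico.1 hj).1
    rw [min_eq_right (by gcongr; omega), min_eq_right (by gcongr), sub_self, mul_zero]
  rw [h0, add_zero]
  refine Finset.sum_congr rfl fun j hj => ?_
  have hj' := Finset.mem_range.1 hj
  rw [min_eq_left (by gcongr; omega), min_eq_left (by gcongr)]

lemma sum_range_sum_Ico_mul (f : ℕ → ℝ) (p n : ℕ) :
    ∑ k ∈ Finset.range n, ∑ j ∈ Finset.Ico (k * p) ((k + 1) * p), f j =
      ∑ j ∈ Finset.range (n * p), f j := by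
  induction n with
  | zero => simp
  | succ n ih =>
    rw [Finset.sum_range_succ, ih, Finset.sum_range_add_sum_Ico _
      (Nat.mul_le_mul_right p (Nat.le_succ n))]

lemma pairwise_disjoint_Ico_mul (p : ℕ) :
    Pairwise fun k l => Disjoint (Finset.Ico (k * p) ((k + 1) * p))
      (Finset.Ico (l * p) ((l + 1) * p)) := by
  have key : ∀ k l : ℕ, k < l → Disjoint (Finset.Ico (k * p) ((k + 1) * p))
      (Finset.Ico (l * p) ((l + 1) * p)) := by
    intro k l hkl
    rw [Finset.disjoint_left]
    intro j hj hj'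
    have h1 := (Finset.mem_Ico.1 hj).2
    have h2 := (Finset.mem_Ico.1 hj').1
    have h3 : (k + 1) * p ≤ l * p := Nat.mul_le_mul_right p hkl
    omega
  intro k l hkl
  rcases lt_or_gt_of_ne hkl with h | h
  · exact key k l h
  · exact (key l k h).symm

variable [MeasurableSpace Ω] {P : Measure Ω}

/-- The Itô integral is a measurable function of the path of the integrator. -/
lemma IsItoIntegralAt.exists_measurable_path (hW : IsPreBrownianReal W P) {t : ℝ} {Y : Ω → ℝ}
    (hY : IsItoIntegralAt P W ν t Y) :
    ∃ Φ : (ℝ≥0 → ℝ) → ℝ, Measurable Φ ∧ Y =ᵐ[P] fun ω => Φ fun s => W s ω := by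
  obtain ⟨φ, -, hae⟩ := (tendstoInMeasure_of_tendsto_eLpNorm (by norm_num)
    (fun m => (memLp_elementaryItoIntegral hW ν m t).aestronglyMeasurable)
    hY.1.aestronglyMeasurable hY.2).exists_seq_tendsto_ae
  -- The limsup of an almost surely convergent subsequence of elementary integrals is measurable on
  -- the whole path space, without reference to `P`.
  refine ⟨fun w => limsup (fun i => elementaryItoIntegral (fun s w => w s) ν (φ i) t w) atTop,
    ?_, ?_⟩
  · refine Measurable.limsup fun i => ?_
    unfold elementaryItoIntegral
    exact Finset.measurable_fun_sum _ fun j _ => measurable_const.mul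
      ((measurable_pi_apply _).sub (measurable_pi_apply _))
  · filter_upwards [hae] with ω hω
    exact hω.limsup_eq.symm

/-- Mean and variance of sums of squared increments of an elementary integral. -/
lemma incrementSq_elementaryItoIntegral [IsProbabilityMeasure P] (hW : IsPreBrownianReal W P)
    {M : ℝ} (hM : ∀ u ∈ Set.Icc (0 : ℝ) 1, |ν u| ≤ M) {K n p : ℕ} (hK : 0 < K) (hn : n ≤ K)
    (hp : 0 < p) :
    MemLp (incrementSq (elementaryItoIntegral W ν (K * p)) K n) 2 P ∧
    ∫ ω, incrementSq (elementaryItoIntegral W ν (K * p)) K n ω ∂P =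
      ∑ j ∈ Finset.range (n * p), ν ((j : ℝ) / (K * p : ℕ)) ^ 2 / (K * p : ℕ) ∧
    Var[incrementSq (elementaryItoIntegral W ν (K * p)) K n; P] ≤
      (∫ x, x ^ 4 ∂gaussianReal 0 1) * M ^ 4 / K := by
  have hm : 0 < K * p := Nat.mul_pos hK hp
  have hm' : (0 : ℝ) < (K * p : ℕ) := by exact_mod_cast hm
  have hK' : (0 : ℝ) < K := by exact_mod_cast hK
  set τ : ℕ → ℝ≥0 := fun j => ((j : ℝ) / (K * p : ℕ)).toNNReal with hτ
  -- The bound on `ν` holds on `[0, 1]` only; cutting off beyond the grid makes it valid for every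
  -- index.
  set c : ℕ → ℝ := fun j => if j < K * p then ν ((j : ℝ) / (K * p : ℕ)) else 0 with hc
  have hcM : ∀ j, c j ^ 2 ≤ M ^ 2 := by
    intro j
    simp only [hc]
    split_ifs with h
    · refine sq_le_sq' ?_ ?_ <;>
      · have := abs_le.1 (hM ((j : ℝ) / (K * p : ℕ)) ⟨by positivity, by
          rw [div_le_one hm']; exact_mod_cast h.le⟩)
        linarith [this.1, this.2]
    · simp only [ne_eq, OfNat.ofNat_ne_zero, not_false_eq_true, zero_pow]
      positivity
  have hτmono : Monotone τ := by
    intro a b hab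
    simp only [hτ]
    gcongr
  set D : ℕ → Ω → ℝ := fun j ω => c j * (W (τ (j + 1)) ω - W (τ j) ω) with hD
  have hDind : iIndepFun D P := (hW.hasIndepIncrements.nat hτmono).comp (fun j x => c j * x)
    fun j => by fun_prop
  set v : ℕ → ℝ≥0 := fun j => NNReal.mk (c j ^ 2) (sq_nonneg _) * nndist (τ (j + 1)).1 (τ j).1 with hv
  have hDlaw : ∀ j, HasLaw (D j) (gaussianReal 0 (v j)) P := by
    intro j
    have := gaussianReal_const_mul (hW.hasLaw_sub (τ (j + 1)) (τ j)) (c j)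
    rw [mul_zero] at this
    exact this
  have hvcoe : ∀ j, (v j : ℝ) = c j ^ 2 / (K * p : ℕ) := by
    intro j
    have hτ' : ∀ i, (τ i).1 = (i : ℝ) / (K * p : ℕ) := fun i =>
      Real.coe_toNNReal _ (by positivity)
    simp only [hv]
    rw [NNReal.coe_mul, coe_nndist, Real.dist_eq, hτ', hτ', ← sub_div, NNReal.coe_mk, Nat.cast_succ,
      add_sub_cancel_left, abs_of_nonneg (by positivity)]
    ring
  have hinc : ∀ k < K, ∀ ω, elementaryItoIntegral W ν (K * p) (((k + 1 : ℕ) : ℝ) / K) ω -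
      elementaryItoIntegral W ν (K * p) ((k : ℝ) / K) ω =
        ∑ j ∈ Finset.Ico (k * p) ((k + 1) * p), D j ω := by
    intro k hk ω
    have hkm : (k + 1) * p ≤ K * p := Nat.mul_le_mul_right p hk
    rw [elementaryItoIntegral_grid W ν hK hk hp, elementaryItoIntegral_grid W ν hK hk.le hp,
      ← Finset.sum_range_add_sum_Ico _ (Nat.mul_le_mul_right p (Nat.le_succ k)),
      add_sub_cancel_left]
    refine Finset.sum_congr rfl fun j hj => ?_
    have := (Finset.mem_Ico.1 hj).2
    simp only [hD, hc, hτ]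
    rw [if_pos (by omega)]
  have hfun : incrementSq (elementaryItoIntegral W ν (K * p)) K n =
      fun ω => ∑ k ∈ Finset.range n, (∑ j ∈ Finset.Ico (k * p) ((k + 1) * p), D j ω) ^ 2 := by
    ext ω
    refine Finset.sum_congr rfl fun k hk => ?_
    rw [hinc k (by have := Finset.mem_range.1 hk; omega)]
  -- A block consists of `p` terms of variance at most `M² / (K p)`. Its square then has variance of
  -- order `M⁴ / K²`, and at most `K` independent blocks give order `M⁴ / K`.
  have hw : ∀ k < n, ((∑ j ∈ Finset.Ico (k * p) ((k + 1) * p), v j : ℝ≥0) : ℝ) ≤ M ^ 2 / K := by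
    intro k _
    push_cast
    have := Finset.sum_le_card_nsmul (Finset.Ico (k * p) ((k + 1) * p)) (fun j => (v j : ℝ))
      (M ^ 2 / (K * p : ℕ)) fun j _ => by
        rw [hvcoe]
        exact div_le_div_of_nonneg_right (hcM j) hm'.le
    refine this.trans (le_of_eq ?_)
    have hcard : (k + 1) * p - k * p = p := by
      rw [Nat.succ_mul]
      omega
    have hp' : (p : ℝ) ≠ 0 := by positivity
    rw [Nat.card_Ico, hcard, nsmul_eq_mul]
    push_cast
    field_simp
  obtain ⟨h1, h2, h3⟩ := sum_sq_block_gaussian hDind hDlaw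
    (fun k => Finset.Ico (k * p) ((k + 1) * p)) (pairwise_disjoint_Ico_mul p) n hw
  rw [hfun]
  refine ⟨h1, ?_, h3.trans ?_⟩
  · rw [h2, sum_range_sum_Ico_mul]
    refine Finset.sum_congr rfl fun j hj => ?_
    have : j < K * p := (Finset.mem_range.1 hj).trans_le (Nat.mul_le_mul_right p hn)
    rw [hvcoe]
    simp only [hc]
    rw [if_pos this]
  · have hn' : (n : ℝ) ≤ K := by exact_mod_cast hn
    have h4 : 0 ≤ ∫ x, x ^ 4 ∂gaussianReal 0 1 := integral_nonneg fun x => by positivity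
    calc (n : ℝ) * ((∫ x, x ^ 4 ∂gaussianReal 0 1) * (M ^ 2 / K) ^ 2)
        ≤ K * ((∫ x, x ^ 4 ∂gaussianReal 0 1) * (M ^ 2 / K) ^ 2) := by gcongr
      _ = _ := by
        field_simp

/-- Mean and variance of sums of squared increments of the Itô integral of a continuous
function. -/
theorem incrementSq_isItoIntegralAt [IsProbabilityMeasure P] (hW : IsPreBrownianReal W P)
    (hν : ContinuousOn ν (Set.Icc 0 1))
    {M : ℝ} (hM : ∀ u ∈ Set.Icc (0 : ℝ) 1, |ν u| ≤ M) {K n : ℕ} (hK : 0 < K) (hn : n ≤ K)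
    {Y : ℝ → Ω → ℝ} (hY : ∀ k ≤ K, IsItoIntegralAt P W ν ((k : ℝ) / K) (Y ((k : ℝ) / K))) :
    MemLp (incrementSq Y K n) 2 P ∧
    ∫ ω, incrementSq Y K n ω ∂P = ∫ u in (0 : ℝ)..((n : ℝ) / K), ν u ^ 2 ∧
    ∫ ω, (incrementSq Y K n ω - ∫ u in (0 : ℝ)..((n : ℝ) / K), ν u ^ 2) ^ 2 ∂P ≤
      (∫ x, x ^ 4 ∂gaussianReal 0 1) * M ^ 4 / K := by
  have hYmem : ∀ k < K, MemLp (fun ω => Y (((k + 1 : ℕ) : ℝ) / K) ω - Y ((k : ℝ) / K) ω) 2 P :=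
    fun k hk => (hY (k + 1) hk).1.sub (hY k hk.le).1
  have hEmem : ∀ p k, MemLp (fun ω => elementaryItoIntegral W ν (K * p) (((k + 1 : ℕ) : ℝ) / K) ω -
      elementaryItoIntegral W ν (K * p) ((k : ℝ) / K) ω) 2 P := fun p k =>
    (memLp_elementaryItoIntegral hW ν (K * p) _).sub (memLp_elementaryItoIntegral hW ν (K * p) _)
  -- The limit is taken along the meshes `1 / (K p)` only, where every increment over a grid cell is
  -- a sum over a block of `p` terms.
  have hsub : Tendsto (fun p : ℕ => K * p) atTop atTop :=
    tendsto_id.const_mul_atTop' hK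
  have hconv : ∀ k < K, Tendsto (fun p => eLpNorm
      ((fun ω => elementaryItoIntegral W ν (K * p) (((k + 1 : ℕ) : ℝ) / K) ω -
      elementaryItoIntegral W ν (K * p) ((k : ℝ) / K) ω) -
      fun ω => Y (((k + 1 : ℕ) : ℝ) / K) ω - Y ((k : ℝ) / K) ω) 2 P) atTop (𝓝 0) := by
    intro k hk
    have h1 := (hY (k + 1) hk).2.comp hsub
    have h2 := (hY k hk.le).2.comp hsub
    have h3 := h1.add h2
    rw [add_zero] at h3
    refine tendsto_of_tendsto_of_tendsto_of_le_of_le tendsto_const_nhds h3 (fun _ => zero_le)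
      fun p => ?_
    have e : ((fun ω => elementaryItoIntegral W ν (K * p) (((k + 1 : ℕ) : ℝ) / K) ω -
      elementaryItoIntegral W ν (K * p) ((k : ℝ) / K) ω) -
      fun ω => Y (((k + 1 : ℕ) : ℝ) / K) ω - Y ((k : ℝ) / K) ω) =
      (elementaryItoIntegral W ν (K * p) (((k + 1 : ℕ) : ℝ) / K) - Y (((k + 1 : ℕ) : ℝ) / K)) -
        (elementaryItoIntegral W ν (K * p) ((k : ℝ) / K) - Y ((k : ℝ) / K)) := by
      ext ω
      simp only [Pi.sub_apply]
      ring
    rw [e]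
    exact eLpNorm_sub_le
      (((memLp_elementaryItoIntegral hW ν (K * p) _).sub (hY (k + 1) hk).1).1)
      (((memLp_elementaryItoIntegral hW ν (K * p) _).sub (hY k hk.le).1).1) one_le_two
  have hsq := fun k hk => tendsto_eLpNorm_sq_sub (fun p => hEmem p k) (hYmem k hk) (hconv k hk)
  have hL1 : Tendsto (fun p => eLpNorm (incrementSq (elementaryItoIntegral W ν (K * p)) K n -
      incrementSq Y K n) 1 P) atTop (𝓝 0) := by
    have hs := tendsto_finsetSum (Finset.range n) fun k (hk : k ∈ Finset.range n) =>
      hsq k ((Finset.mem_range.1 hk).trans_le hn)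
    rw [Finset.sum_const_zero] at hs
    refine tendsto_of_tendsto_of_tendsto_of_le_of_le tendsto_const_nhds hs (fun _ => zero_le)
      fun p => ?_
    have e : incrementSq (elementaryItoIntegral W ν (K * p)) K n - incrementSq Y K n =
        ∑ k ∈ Finset.range n,
          ((fun ω => (elementaryItoIntegral W ν (K * p) (((k + 1 : ℕ) : ℝ) / K) ω -
            elementaryItoIntegral W ν (K * p) ((k : ℝ) / K) ω) ^ 2) -
          fun ω => (Y (((k + 1 : ℕ) : ℝ) / K) ω - Y ((k : ℝ) / K) ω) ^ 2) := by
      ext ω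
      simp [incrementSq, Finset.sum_apply]
    rw [e]
    exact eLpNorm_sum_le (fun k hk => ((hEmem p k).1.pow 2).sub
      ((hYmem k ((Finset.mem_range.1 hk).trans_le hn)).1.pow 2)) le_rfl
  have hmean : Tendsto (fun p => ∫ ω, incrementSq (elementaryItoIntegral W ν (K * p)) K n ω ∂P)
      atTop (𝓝 (∫ u in (0 : ℝ)..((n : ℝ) / K), ν u ^ 2)) := by
    refine (tendsto_riemann_sum (hν.pow 2) hK hn).congr' ?_
    filter_upwards [eventually_gt_atTop 0] with p hp
    exact (incrementSq_elementaryItoIntegral hW hM hK hn hp).2.1.symm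
  refine memLp_and_variance_le_of_tendsto_L1 ?_ ?_ hL1 hmean
  · filter_upwards [eventually_gt_atTop 0] with p hp
    have := incrementSq_elementaryItoIntegral hW hM hK hn hp
    exact ⟨this.1, this.2.2⟩
  · exact integrable_finsetSum _ fun k hk =>
      (hYmem k ((Finset.mem_range.1 hk).trans_le hn)).integrable_sq

end ItoIncrements

/-! ### Lower bound for the size of the jump. -/

section Signal

lemma ContinuousOn.intervalIntegrable_zero {f : ℝ → ℝ} (hf : ContinuousOn f (Set.Icc 0 1)) {u : ℝ}
    (hu : u ∈ Set.Icc (0 : ℝ) 1) : IntervalIntegrable f volume 0 u := by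
  refine ContinuousOn.intervalIntegrable (hf.mono ?_)
  rw [Set.uIcc_of_le hu.1]
  exact Set.Icc_subset_Icc le_rfl hu.2

lemma continuousOn_integral_zero {f : ℝ → ℝ} (hf : ContinuousOn f (Set.Icc 0 1)) :
    ContinuousOn (fun u => ∫ x in (0 : ℝ)..u, f x) (Set.Icc 0 1) := by
  have h := intervalIntegral.continuousOn_primitive_interval (μ := volume) (f := f) (a := 0)
    (b := 1) (by
      rw [Set.uIcc_of_le zero_le_one]
      exact hf.integrableOn_Icc)
  rwa [Set.uIcc_of_le zero_le_one] at h

lemma eqOn_zero_of_integral_eq_zero {ψ : ℝ → ℝ} (hψ : ContinuousOn ψ (Set.Icc 0 1))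
    (h : ∀ u ∈ Set.Icc (0 : ℝ) 1, ∫ x in (0 : ℝ)..u, ψ x = 0) :
    Set.EqOn ψ (fun _ => 0) (Set.Icc 0 1) := by
  refine Set.EqOn.of_subset_closure (s := Set.Ioo 0 1) ?_ hψ continuousOn_const
    Set.Ioo_subset_Icc_self (by rw [closure_Ioo zero_ne_one])
  intro u hu
  have hmem : Set.Icc (0 : ℝ) 1 ∈ 𝓝 u := Icc_mem_nhds hu.1 hu.2
  have hd := intervalIntegral.integral_hasDerivAt_right
    (hψ.intervalIntegrable_zero (Set.Ioo_subset_Icc_self hu))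
    ((hψ.mono Set.Ioo_subset_Icc_self).stronglyMeasurableAtFilter isOpen_Ioo u hu)
    (hψ.continuousAt hmem)
  have hd' : HasDerivAt (fun u => ∫ x in (0 : ℝ)..u, ψ x) 0 u := by
    refine (hasDerivAt_const u (0 : ℝ)).congr_of_eventuallyEq ?_
    filter_upwards [hmem] with x hx using h x hx
  exact hd.unique hd'

lemma integral_add_mul_sq {X Y : ℝ → ℝ} (hX : ContinuousOn X (Set.Icc 0 1))
    (hY : ContinuousOn Y (Set.Icc 0 1)) (a : ℝ) {u : ℝ} (hu : u ∈ Set.Icc (0 : ℝ) 1) :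
    ∫ x in (0 : ℝ)..u, (X x + a * Y x) ^ 2 = (∫ x in (0 : ℝ)..u, X x ^ 2) +
      2 * a * (∫ x in (0 : ℝ)..u, X x * Y x) + a ^ 2 * ∫ x in (0 : ℝ)..u, Y x ^ 2 := by
  have i1 : IntervalIntegrable (fun x => X x ^ 2) volume 0 u :=
    (hX.pow 2).intervalIntegrable_zero hu
  have i2 : IntervalIntegrable (fun x => 2 * a * (X x * Y x)) volume 0 u :=
    ((hX.mul hY).intervalIntegrable_zero hu).const_mul _
  have i3 : IntervalIntegrable (fun x => a ^ 2 * Y x ^ 2) volume 0 u :=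
    ((hY.pow 2).intervalIntegrable_zero hu).const_mul _
  rw [← intervalIntegral.integral_const_mul, ← intervalIntegral.integral_const_mul,
    ← intervalIntegral.integral_add i1 i2, ← intervalIntegral.integral_add (i1.add i2) i3]
  exact intervalIntegral.integral_congr fun u _ => by ring

/-- Uniform lower bound of the discretized squared `L²` norms of a line of continuous functions
which does not pass through `0`. -/
lemma exists_le_sum_grid_sq {X Y : ℝ → ℝ} (hX : ContinuousOn X (Set.Icc 0 1))
    (hY : ContinuousOn Y (Set.Icc 0 1)) {B : ℝ} (hB : 0 ≤ B)
    (hne : ∀ a ∈ Set.Icc 0 B, ∃ u ∈ Set.Icc (0 : ℝ) 1, X u + a * Y u ≠ 0) :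
    ∃ c : ℝ, 0 < c ∧ ∃ K₀ : ℕ, ∀ K ≥ K₀, ∀ a ∈ Set.Icc 0 B,
      c ≤ ∑ k ∈ Finset.range K, (X ((k : ℝ) / K) + a * Y ((k : ℝ) / K)) ^ 2 / K := by
  have h01 : (1 : ℝ) ∈ Set.Icc (0 : ℝ) 1 := ⟨zero_le_one, le_rfl⟩
  have hcont : ∀ a : ℝ, ContinuousOn (fun u => (X u + a * Y u) ^ 2) (Set.Icc 0 1) := fun a =>
    (hX.add (continuousOn_const.mul hY)).pow 2
  set J : ℝ → ℝ := fun a => ∫ u in (0 : ℝ)..1, (X u + a * Y u) ^ 2 with hJ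
  have hJpoly : J = fun a => (∫ u in (0 : ℝ)..1, X u ^ 2) +
      2 * a * (∫ u in (0 : ℝ)..1, X u * Y u) + a ^ 2 * ∫ u in (0 : ℝ)..1, Y u ^ 2 := by
    ext a
    exact integral_add_mul_sq hX hY a h01
  have hJc : Continuous J := by
    rw [hJpoly]
    fun_prop
  have hJpos : ∀ a ∈ Set.Icc 0 B, 0 < J a := by
    intro a ha
    obtain ⟨u, hu, hne⟩ := hne a ha
    exact intervalIntegral.integral_pos zero_lt_one (hcont a) (fun x _ => sq_nonneg _)
      ⟨u, hu, by positivity⟩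
  -- `J` is a quadratic polynomial, positive on the compact `[0, B]`, hence bounded below there.
  -- Half of its minimum is given up for the discretization, uniformly in `a` by joint uniform
  -- continuity.
  obtain ⟨a₀, ha₀, hmin⟩ := (isCompact_Icc (a := (0 : ℝ)) (b := B)).exists_isMinOn
    ⟨0, le_rfl, hB⟩ hJc.continuousOn
  have hc₀ := hJpos a₀ ha₀
  have huc : UniformContinuousOn (fun z : ℝ × ℝ => (X z.2 + z.1 * Y z.2) ^ 2)
      (Set.Icc 0 B ×ˢ Set.Icc 0 1) := by
    refine (isCompact_Icc.prod isCompact_Icc).uniformContinuousOn_of_continuous ?_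
    have hsnd : Set.MapsTo (fun z : ℝ × ℝ => z.2) (Set.Icc 0 B ×ˢ Set.Icc 0 1) (Set.Icc 0 1) :=
      fun z hz => hz.2
    exact ((hX.comp continuousOn_snd hsnd).add
      (continuousOn_fst.mul (hY.comp continuousOn_snd hsnd))).pow 2
  rw [Metric.uniformContinuousOn_iff_le] at huc
  obtain ⟨δ, hδ, h⟩ := huc (J a₀ / 2) (by positivity)
  obtain ⟨K₀, hK₀⟩ := exists_nat_one_div_lt hδ
  refine ⟨J a₀ / 2, by positivity, K₀ + 1, fun K hK a ha => ?_⟩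
  have hKpos : 0 < K := by omega
  have hK' : (0 : ℝ) < K := by exact_mod_cast hKpos
  have key := abs_integral_sub_sum_grid_le (f := fun u => (X u + a * Y u) ^ 2)
    (q := fun k => (X ((k : ℝ) / K) + a * Y ((k : ℝ) / K)) ^ 2) (L := K) (ε := J a₀ / 2) hKpos
    (fun j hj => intervalIntegrable_grid hKpos le_rfl (hcont a) hj) ?_
  · rw [div_self hK'.ne', mul_one] at key
    have h1 : J a₀ ≤ J a := hmin ha
    have h2 := (abs_le.1 key).2
    simp only [hJ] at h1 h2 ⊢
    linarith
  · intro j hj u hu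
    have hj1 : ((j + 1 : ℕ) : ℝ) / K ≤ 1 := by
      rw [div_le_one hK']
      exact_mod_cast hj
    have hj0 : (0 : ℝ) ≤ (j : ℝ) / K := by positivity
    have hlen : ((j + 1 : ℕ) : ℝ) / K = (j : ℝ) / K + 1 / K := by
      push_cast
      ring
    have hpm : 1 / (K : ℝ) ≤ 1 / ((K₀ : ℝ) + 1) := by
      apply one_div_le_one_div_of_le (by positivity)
      exact_mod_cast hK
    have := h (a, u) ⟨ha, hj0.trans hu.1.le, hu.2.le.trans hj1⟩ (a, (j : ℝ) / K)
      ⟨ha, hj0, (hu.1.trans hu.2).le.trans hj1⟩ (by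
        rw [Prod.dist_eq, dist_self, Real.dist_eq, abs_of_pos (by linarith [hu.1])]
        exact max_le hδ.le (by linarith [hu.2]))
    rwa [Real.dist_eq] at this

variable {σ₁ σt : ℝ → ℝ}

/-- If the expression vanished identically, differentiation and division by `σ₁²` would give `2 ρ +
a ρ² = p / q` for `ρ = σt / σ₁`. The left side is strictly increasing in `ρ > 0`, so `ρ` would be
constant. The case `a = 0` is included because the alternatives may shrink to zero. -/
lemma exists_line_ne_zero (hσ₁ : ContinuousOn σ₁ (Set.Icc 0 1))
    (hσ₁pos : ∀ u ∈ Set.Icc (0 : ℝ) 1, 0 < σ₁ u) (hσt : ContinuousOn σt (Set.Icc 0 1))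
    (hσtpos : ∀ u ∈ Set.Icc (0 : ℝ) 1, 0 < σt u)
    (hratio : ¬ ∃ c : ℝ, ∀ u ∈ Set.Icc (0 : ℝ) 1, σt u / σ₁ u = c) {a p q : ℝ} (ha : 0 ≤ a)
    (hq : 0 < q) :
    ∃ u ∈ Set.Icc (0 : ℝ) 1, p * (∫ x in (0 : ℝ)..u, σ₁ x ^ 2) -
      q * (2 * (∫ x in (0 : ℝ)..u, σ₁ x * σt x) + a * ∫ x in (0 : ℝ)..u, σt x ^ 2) ≠ 0 := by
  by_contra! hcon
  have hψ : ContinuousOn (fun u => p * σ₁ u ^ 2 - q * (2 * (σ₁ u * σt u) + a * σt u ^ 2))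
      (Set.Icc 0 1) := by fun_prop
  have hzero := eqOn_zero_of_integral_eq_zero hψ fun u hu => by
    have i1 : IntervalIntegrable (fun x => σ₁ x ^ 2) volume 0 u :=
      (hσ₁.pow 2).intervalIntegrable_zero hu
    have i2 : IntervalIntegrable (fun x => σ₁ x * σt x) volume 0 u :=
      (hσ₁.mul hσt).intervalIntegrable_zero hu
    have i3 : IntervalIntegrable (fun x => σt x ^ 2) volume 0 u :=
      (hσt.pow 2).intervalIntegrable_zero hu
    rw [intervalIntegral.integral_sub (i1.const_mul p)
      (((i2.const_mul 2).add (i3.const_mul a)).const_mul q),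
      intervalIntegral.integral_const_mul, intervalIntegral.integral_const_mul,
      intervalIntegral.integral_add (i2.const_mul 2) (i3.const_mul a),
      intervalIntegral.integral_const_mul, intervalIntegral.integral_const_mul]
    exact hcon u hu
  have hr : ∀ u ∈ Set.Icc (0 : ℝ) 1, 2 * (σt u / σ₁ u) + a * (σt u / σ₁ u) ^ 2 = p / q := by
    intro u hu
    have h1 := hzero hu
    have h2 := hσ₁pos u hu
    simp only at h1
    rw [eq_div_iff hq.ne']
    field_simp
    linarith
  refine hratio ⟨σt 0 / σ₁ 0, fun u hu => ?_⟩
  have h0 : (0 : ℝ) ∈ Set.Icc (0 : ℝ) 1 := ⟨le_rfl, zero_le_one⟩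
  have e := (hr u hu).trans (hr 0 h0).symm
  have h1 : 0 < σt u / σ₁ u := div_pos (hσtpos u hu) (hσ₁pos u hu)
  have h2 : 0 < σt 0 / σ₁ 0 := div_pos (hσtpos 0 h0) (hσ₁pos 0 h0)
  have e2 : (σt u / σ₁ u - σt 0 / σ₁ 0) * (2 + a * (σt u / σ₁ u + σt 0 / σ₁ 0)) = 0 := by
    linear_combination e
  rcases mul_eq_zero.1 e2 with h | h
  · linarith
  · have : 0 ≤ a * (σt u / σ₁ u + σt 0 / σ₁ 0) := by positivity
    linarith

/-- The standardized integrated squared volatility `∫₀ᵘ ν² / ∫₀¹ ν²`. -/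
noncomputable def stdIntegratedSq (ν : ℝ → ℝ) (u : ℝ) : ℝ :=
  (∫ x in (0 : ℝ)..u, ν x ^ 2) / ∫ x in (0 : ℝ)..1, ν x ^ 2

/-- The discretized `L²` distance of the standardized integrated squared volatilities under local
alternatives is at least of the order `a`. -/
theorem exists_mul_sq_le_sum_grid_stdIntegratedSq (hσ₁ : ContinuousOn σ₁ (Set.Icc 0 1))
    (hσ₁pos : ∀ u ∈ Set.Icc (0 : ℝ) 1, 0 < σ₁ u) (hσt : ContinuousOn σt (Set.Icc 0 1))
    (hσtpos : ∀ u ∈ Set.Icc (0 : ℝ) 1, 0 < σt u)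
    (hratio : ¬ ∃ c : ℝ, ∀ u ∈ Set.Icc (0 : ℝ) 1, σt u / σ₁ u = c) {B : ℝ} (hB : 0 ≤ B) :
    ∃ c : ℝ, 0 < c ∧ ∃ K₀ : ℕ, ∀ K ≥ K₀, ∀ a ∈ Set.Icc 0 B,
      c * a ^ 2 ≤ ∑ k ∈ Finset.range K, (stdIntegratedSq σ₁ ((k : ℝ) / K) -
        stdIntegratedSq (fun u => σ₁ u + a * σt u) ((k : ℝ) / K)) ^ 2 / K := by
  have h01 : (1 : ℝ) ∈ Set.Icc (0 : ℝ) 1 := ⟨zero_le_one, le_rfl⟩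
  set V : ℝ → ℝ := fun u => ∫ x in (0 : ℝ)..u, σ₁ x ^ 2 with hV
  set A : ℝ → ℝ := fun u => ∫ x in (0 : ℝ)..u, σ₁ x * σt x with hA
  set Q : ℝ → ℝ := fun u => ∫ x in (0 : ℝ)..u, σt x ^ 2 with hQ
  have hVc : ContinuousOn V (Set.Icc 0 1) := continuousOn_integral_zero (hσ₁.pow 2)
  have hAc : ContinuousOn A (Set.Icc 0 1) := continuousOn_integral_zero (hσ₁.mul hσt)
  have hQc : ContinuousOn Q (Set.Icc 0 1) := continuousOn_integral_zero (hσt.pow 2)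
  have hV1 : 0 < V 1 := intervalIntegral.integral_pos zero_lt_one (hσ₁.pow 2)
    (fun x _ => sq_nonneg _) ⟨1, h01, pow_pos (hσ₁pos 1 h01) 2⟩
  have hA1 : 0 ≤ A 1 := intervalIntegral.integral_nonneg zero_le_one
    fun x hx => (mul_pos (hσ₁pos x hx) (hσtpos x hx)).le
  have hQ1 : 0 ≤ Q 1 := intervalIntegral.integral_nonneg zero_le_one fun x hx => sq_nonneg _
  -- `X + a Y` is what remains of the numerator of the difference of the two standardized functions
  -- once the terms `V u * V 1` cancel and a factor `a` is taken out. That factor produces the `a²`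
  -- of the claim.
  obtain ⟨c, hc, K₀, h⟩ := exists_le_sum_grid_sq
    (X := fun u => V u * (2 * A 1) - V 1 * (2 * A u)) (Y := fun u => V u * Q 1 - V 1 * Q u)
    (by fun_prop) (by fun_prop) hB fun a ha => by
      obtain ⟨u, hu, hne⟩ := exists_line_ne_zero hσ₁ hσ₁pos hσt hσtpos hratio
        (p := 2 * A 1 + a * Q 1) (q := V 1) ha.1 hV1
      refine ⟨u, hu, fun h0 => hne ?_⟩
      change (2 * A 1 + a * Q 1) * V u - V 1 * (2 * A u + a * Q u) = 0
      linear_combination h0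
  have hsum : ∀ a u, u ∈ Set.Icc (0 : ℝ) 1 →
      ∫ x in (0 : ℝ)..u, (σ₁ x + a * σt x) ^ 2 = V u + 2 * a * A u + a ^ 2 * Q u := by
    intro a u hu
    exact integral_add_mul_sq hσ₁ hσt a hu
  -- `T` bounds the total integrated squared volatility after the change, for all `a ≤ B`.
  set T : ℝ := V 1 + 2 * B * A 1 + B ^ 2 * Q 1 with hT
  have hTpos : 0 < T := by positivity
  refine ⟨c / (V 1 * T) ^ 2, by positivity, K₀, fun K hK a ha => ?_⟩
  have hKa := h K hK a ha
  have ha0 : 0 ≤ a := ha.1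
  have hV2 : 0 < V 1 + 2 * a * A 1 + a ^ 2 * Q 1 := by positivity
  have hV2T : V 1 + 2 * a * A 1 + a ^ 2 * Q 1 ≤ T := by
    rw [hT]
    gcongr <;> exact ha.2
  have hterm : ∀ k ∈ Finset.range K, a ^ 2 / (V 1 * T) ^ 2 *
      ((V ((k : ℝ) / K) * (2 * A 1) - V 1 * (2 * A ((k : ℝ) / K)) +
        a * (V ((k : ℝ) / K) * Q 1 - V 1 * Q ((k : ℝ) / K))) ^ 2 / K) ≤
      (stdIntegratedSq σ₁ ((k : ℝ) / K) -
        stdIntegratedSq (fun u => σ₁ u + a * σt u) ((k : ℝ) / K)) ^ 2 / K := by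
    intro k hk
    have hk' := Finset.mem_range.1 hk
    have hKpos : (0 : ℝ) < K := by exact_mod_cast (Nat.zero_le k).trans_lt hk'
    have hkK : (k : ℝ) / K ∈ Set.Icc (0 : ℝ) 1 :=
      ⟨by positivity, by rw [div_le_one hKpos]; exact_mod_cast hk'.le⟩
    have e : stdIntegratedSq σ₁ ((k : ℝ) / K) -
        stdIntegratedSq (fun u => σ₁ u + a * σt u) ((k : ℝ) / K) =
        a * (V ((k : ℝ) / K) * (2 * A 1) - V 1 * (2 * A ((k : ℝ) / K)) +
        a * (V ((k : ℝ) / K) * Q 1 - V 1 * Q ((k : ℝ) / K))) /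
          (V 1 * (V 1 + 2 * a * A 1 + a ^ 2 * Q 1)) := by
      rw [stdIntegratedSq, stdIntegratedSq, hsum a _ hkK, hsum a _ h01]
      change V _ / V 1 - _ = _
      field_simp
      ring
    rw [e, div_pow, mul_pow a, ← mul_div_assoc, div_mul_eq_mul_div]
    gcongr
  calc c / (V 1 * T) ^ 2 * a ^ 2 = a ^ 2 / (V 1 * T) ^ 2 * c := by ring
    _ ≤ a ^ 2 / (V 1 * T) ^ 2 * _ := mul_le_mul_of_nonneg_left hKa (by positivity)
    _ ≤ _ := by
      rw [Finset.mul_sum]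
      exact Finset.sum_le_sum hterm

end Signal

/-! ### From step functions to vectors. -/

section GridVectors

/-- On the cell that starts at `k / K` the indicator keeps exactly the first `k` increments,
numbered from `1` on one side and from `0` on the other. -/
lemma realizedQV_eq_incrementSq {Ω : Type*} (Y : ℝ → Ω → ℝ) (ω : Ω) {K k : ℕ} (hK : 0 < K)
    (hk : k ≤ K) {u : ℝ} (h1 : (k : ℝ) / K ≤ u) (h2 : u < ((k + 1 : ℕ) : ℝ) / K) :
    realizedQV (fun t => Y t ω) K u = incrementSq Y K k ω := by
  have hK' : (0 : ℝ) < K := by exact_mod_cast hK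
  have hiff : ∀ j : ℕ, (j : ℝ) / K ≤ u ↔ j ≤ k := by
    intro j
    constructor
    · intro h
      have h3 := h.trans_lt h2
      rw [div_lt_div_iff_of_pos_right hK'] at h3
      have : j < k + 1 := by exact_mod_cast h3
      omega
    · intro h
      refine le_trans ?_ h1
      gcongr
  rw [realizedQV, incrementSq, Finset.sum_ite, Finset.sum_const_zero, add_zero]
  have e : (Finset.Icc 1 K).filter (fun j : ℕ => (j : ℝ) / K ≤ u) =
      (Finset.range k).map (addRightEmbedding 1) := by
    ext j
    simp only [Finset.mem_filter, Finset.mem_Icc, hiff, Finset.mem_map, Finset.mem_range,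
      addRightEmbedding_apply]
    constructor
    · rintro ⟨⟨h3, -⟩, h4⟩
      exact ⟨j - 1, by omega, by omega⟩
    · rintro ⟨i, hi, rfl⟩
      omega
  rw [e, Finset.sum_map]
  refine Finset.sum_congr rfl fun l _ => ?_
  simp only [addRightEmbedding_apply]
  rw [sq_abs]
  push_cast
  rw [add_sub_cancel_right]

lemma standardizedQV_eq_div {Ω : Type*} (Y : ℝ → Ω → ℝ) (ω : Ω) {K k : ℕ} (hK : 0 < K)
    (hk : k ≤ K) {u : ℝ} (h1 : (k : ℝ) / K ≤ u) (h2 : u < ((k + 1 : ℕ) : ℝ) / K) :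
    standardizedQV (fun t => Y t ω) K u = incrementSq Y K k ω / incrementSq Y K K ω := by
  have hK' : (0 : ℝ) < K := by exact_mod_cast hK
  rw [standardizedQV, realizedQV_eq_incrementSq Y ω hK hk h1 h2,
    realizedQV_eq_incrementSq Y ω hK le_rfl (k := K) (u := 1) (by rw [div_self hK'.ne'])
      (by rw [lt_div_iff₀ hK']; push_cast; linarith)]

/-- The vector of the values of `r` at `0, …, K - 1`, normalized so that its squared norm is the
average of the squares. -/
noncomputable def gridVec (r : ℕ → ℝ) (K : ℕ) : EuclideanSpace ℝ (Fin K) :=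
  WithLp.toLp 2 fun k => r k / √(K : ℝ)

lemma gridVec_apply (r : ℕ → ℝ) (K : ℕ) (k : Fin K) : gridVec r K k = r k / √(K : ℝ) := rfl

lemma norm_sq_gridVec (r : ℕ → ℝ) (K : ℕ) :
    ‖gridVec r K‖ ^ 2 = ∑ k ∈ Finset.range K, r k ^ 2 / K := by
  rw [EuclideanSpace.real_norm_sq_eq, ← Fin.sum_univ_eq_sum_range (fun k => r k ^ 2 / (K : ℝ))]
  refine Finset.sum_congr rfl fun k _ => ?_
  rw [gridVec_apply, div_pow, Real.sq_sqrt (Nat.cast_nonneg K)]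

lemma gridVec_sub (r s : ℕ → ℝ) (K : ℕ) :
    gridVec r K - gridVec s K = gridVec (fun k => r k - s k) K := by
  ext k
  simp only [PiLp.sub_apply, gridVec_apply]
  ring

lemma cusumVec_gridVec (r : ℕ → ℕ → ℝ) (K N n : ℕ) :
    cusumVec (fun i => gridVec (r i) K) N n =
      gridVec (fun k => ∑ i ∈ Finset.Icc 1 n, r i k -
        (n : ℝ) / N * ∑ i ∈ Finset.Icc 1 N, r i k) K := by
  ext k
  simp only [cusumVec, PiLp.sub_apply, PiLp.smul_apply, WithLp.ofLp_sum, Finset.sum_apply,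
    gridVec_apply, smul_eq_mul, ← Finset.sum_div]
  ring

/-- The integrand is constant on each open cell, so the integral is an average of `K` values with no
discretization error. -/
lemma cusum_eq_norm_sq_cusumVec {F : ℕ → ℝ → ℝ} {r : ℕ → ℕ → ℝ} {K : ℕ} (hK : 0 < K)
    (hF : ∀ i, ∀ k < K, ∀ u ∈ Set.Ioo ((k : ℝ) / K) (((k + 1 : ℕ) : ℝ) / K), F i u = r i k)
    (N n : ℕ) :
    cusum F N n = ‖cusumVec (fun i => gridVec (r i) K) N n‖ ^ 2 := by
  have hK' : (0 : ℝ) < K := by exact_mod_cast hK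
  rw [cusumVec_gridVec, norm_sq_gridVec, cusum]
  set q : ℕ → ℝ := fun k => (∑ i ∈ Finset.Icc 1 n, r i k -
    (n : ℝ) / N * ∑ i ∈ Finset.Icc 1 N, r i k) ^ 2 with hq
  have hconst : ∀ k < K, ∀ u ∈ Set.Ioo ((k : ℝ) / K) (((k + 1 : ℕ) : ℝ) / K),
      (∑ i ∈ Finset.Icc 1 n, F i u - (n : ℝ) / N * ∑ i ∈ Finset.Icc 1 N, F i u) ^ 2 = q k := by
    intro k hk u hu
    simp only [hq, fun i => hF i k hk u hu]
  have key := abs_integral_sub_sum_grid_le (q := q) (L := K) (ε := 0) hK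
    (f := fun u => (∑ i ∈ Finset.Icc 1 n, F i u -
      (n : ℝ) / N * ∑ i ∈ Finset.Icc 1 N, F i u) ^ 2) (fun k hk => ?_)
    (fun k hk u hu => by rw [hconst k hk u hu, sub_self, abs_zero])
  · rw [div_self hK'.ne', zero_mul] at key
    exact sub_eq_zero.1 (abs_nonpos_iff.1 key)
  · rw [intervalIntegrable_iff_integrableOn_Ioo_of_le (by gcongr; omega)]
    exact (integrableOn_const (C := q k) (by simp)).congr_fun
      (fun u hu => (hconst k hk u hu).symm) measurableSet_Ioo

end GridVectors

/-! ### The standardized quadratic variation as a random vector. -/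

section SampleVectors

/-- The mean minimizes the mean squared distance, so the error around the explicit target bounds the
variance. -/
lemma integral_norm_sub_integral_sq_le {Ω : Type*} [MeasurableSpace Ω] {P : Measure Ω}
    [IsProbabilityMeasure P] {H : Type*} [NormedAddCommGroup H] [InnerProductSpace ℝ H]
    [CompleteSpace H] {Z : Ω → H} (hZ : MemLp Z 2 P) (f : H) :
    ∫ ω, ‖Z ω - ∫ ω', Z ω' ∂P‖ ^ 2 ∂P ≤ ∫ ω, ‖Z ω - f‖ ^ 2 ∂P := by
  set m := ∫ ω', Z ω' ∂P with hm
  have hZi := hZ.integrable one_le_two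
  have hc : MemLp (fun ω => Z ω - m) 2 P := hZ.sub (memLp_const m)
  have hI : Integrable (fun ω => inner ℝ (m - f) (Z ω - m)) P :=
    (hc.integrable one_le_two).const_inner _
  have h0 : ∫ ω, inner ℝ (m - f) (Z ω - m) ∂P = 0 := by
    rw [integral_inner (hc.integrable one_le_two), integral_sub hZi (integrable_const m)]
    simp [hm]
  calc ∫ ω, ‖Z ω - m‖ ^ 2 ∂P = ∫ ω, (‖Z ω - m‖ ^ 2 + 2 * inner ℝ (m - f) (Z ω - m)) ∂P := by
        rw [integral_add hc.norm.integrable_sq (hI.const_mul 2), integral_const_mul, h0, mul_zero,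
          add_zero]
    _ ≤ ∫ ω, ‖Z ω - f‖ ^ 2 ∂P := by
        refine integral_mono (hc.norm.integrable_sq.add (hI.const_mul 2))
          (hZ.sub (memLp_const f)).norm.integrable_sq fun ω => ?_
        simp only
        rw [show Z ω - f = (Z ω - m) + (m - f) by abel, norm_add_sq_real,
          real_inner_comm (m - f) (Z ω - m)]
        have : 0 ≤ ‖m - f‖ ^ 2 := by positivity
        linarith

variable {Ω : Type*} [MeasurableSpace Ω] {P : Measure Ω} [IsProbabilityMeasure P]

/-- Bias and mean squared error of a vector of ratios of random variables. -/
lemma gridVec_ratio_bias_and_variance {A : ℕ → Ω → ℝ} {K : ℕ} {α : ℕ → ℝ} {s τ : ℝ}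
    (hK : 0 < K)
    (hA : ∀ k ≤ K, MemLp (A k) 2 P) (hA0 : ∀ k ω, 0 ≤ A k ω)
    (hAK : ∀ k ≤ K, ∀ ω, A k ω ≤ A K ω) (hα : ∀ k ≤ K, ∫ ω, A k ω ∂P = α k)
    (hτ : 0 < τ) (hτα : τ ≤ α K)
    (hs : ∀ k ≤ K, ∫ ω, (A k ω - α k) ^ 2 ∂P ≤ s) :
    MemLp (fun ω => gridVec (fun k => A k ω / A K ω) K) 2 P ∧
    ‖∫ ω, gridVec (fun k => A k ω / A K ω) K ∂P - gridVec (fun k => α k / α K) K‖ ≤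
      8 * s / τ ^ 2 ∧
    ∫ ω, ‖gridVec (fun k => A k ω / A K ω) K -
      ∫ ω', gridVec (fun k => A k ω' / A K ω') K ∂P‖ ^ 2 ∂P ≤ 20 * s / τ ^ 2 := by
  have hK' : (0 : ℝ) < K := by exact_mod_cast hK
  have hαK : 0 < α K := hτ.trans_le hτα
  have hs0 : 0 ≤ s := le_trans (integral_nonneg fun ω => sq_nonneg _) (hs K le_rfl)
  have hratio := fun k (hk : k ≤ K) => abs_integral_div_sub_le_and_integral_sq_le (hA k hk)
    (hA K le_rfl) (hA0 k) (hAK k hk) hαK (hα k hk) (hα K le_rfl) (hs k hk) (hs K le_rfl)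
  have hR := fun k (hk : k ≤ K) => integrable_div_of_le (hA k hk).1 (hA K le_rfl).1 (hA0 k)
    (hAK k hk)
  have hR2 : ∀ k ≤ K, MemLp (fun ω => A k ω / A K ω) 2 P := fun k hk =>
    MemLp.of_bound (hR k hk).1 1 (Eventually.of_forall fun ω => by
      have := div_mem_Icc_of_le (hA0 k ω) (hAK k hk ω)
      rw [Real.norm_of_nonneg this.1]
      exact this.2)
  have hZ : MemLp (fun ω => gridVec (fun k => A k ω / A K ω) K) 2 P := by
    rw [memLp_piLp_iff]
    intro k
    simp only [gridVec_apply]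
    simpa [div_eq_mul_inv] using (hR2 k k.2.le).mul_const (√(K : ℝ))⁻¹
  have hmono : ∀ {x : ℝ}, 0 ≤ x → x / α K ^ 2 ≤ x / τ ^ 2 := fun hx => by gcongr
  -- The squared norm of a grid vector is an average over coordinates, so coordinatewise bounds
  -- carry over with no factor of the dimension `K`.
  have hsumle : ∀ (f : ℕ → ℝ) (b : ℝ), (∀ k < K, f k ≤ b) →
      ∑ k ∈ Finset.range K, f k / K ≤ b := by
    intro f b hf
    rw [← Finset.sum_div, div_le_iff₀ hK']
    have := Finset.sum_le_card_nsmul (Finset.range K) f b fun k hk => hf k (Finset.mem_range.1 hk)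
    simp only [Finset.card_range, nsmul_eq_mul] at this
    linarith
  refine ⟨hZ, ?_, ?_⟩
  · have e : ∫ ω, gridVec (fun k => A k ω / A K ω) K ∂P =
        gridVec (fun k => ∫ ω, A k ω / A K ω ∂P) K := by
      ext k
      have h := ((EuclideanSpace.proj k : EuclideanSpace ℝ (Fin K) →L[ℝ] ℝ).integral_comp_comm
        (hZ.integrable one_le_two))
      simp only [PiLp.proj_apply, gridVec_apply] at h
      rw [integral_div] at h
      rw [gridVec_apply]
      exact h.symm
    rw [e, gridVec_sub]
    have h8 : 0 ≤ 8 * s / τ ^ 2 := by positivity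
    refine (sq_le_sq₀ (norm_nonneg _) h8).1 ?_
    rw [norm_sq_gridVec]
    refine hsumle _ _ fun k hk => ?_
    rw [← sq_abs]
    have := (hratio k hk.le).1.trans (hmono (by positivity))
    gcongr
  · refine (integral_norm_sub_integral_sq_le hZ (gridVec (fun k => α k / α K) K)).trans ?_
    simp_rw [gridVec_sub, norm_sq_gridVec]
    have hI : ∀ k ∈ Finset.range K, Integrable
        (fun ω => (A k ω / A K ω - α k / α K) ^ 2 / (K : ℝ)) P := fun k hk =>
      ((hR2 k (Finset.mem_range.1 hk).le).sub (memLp_const _)).integrable_sq.div_const _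
    rw [integral_finsetSum _ hI]
    simp_rw [integral_div]
    exact hsumle _ _ fun k hk => (hratio k hk.le).2.trans (hmono (by positivity))

lemma measurable_incrementSq {Ω : Type*} [MeasurableSpace Ω] {Y : ℝ → Ω → ℝ}
    (hY : ∀ t, Measurable (Y t)) (K n : ℕ) : Measurable (incrementSq Y K n) := by
  unfold incrementSq
  exact Finset.measurable_fun_sum _ fun k _ => ((hY _).sub (hY _)).pow_const 2

lemma incrementSq_nonneg {Ω : Type*} (Y : ℝ → Ω → ℝ) (K n : ℕ) (ω : Ω) :
    0 ≤ incrementSq Y K n ω :=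
  Finset.sum_nonneg fun _ _ => sq_nonneg _

lemma incrementSq_mono {Ω : Type*} (Y : ℝ → Ω → ℝ) (K : ℕ) (ω : Ω) {n m : ℕ} (h : n ≤ m) :
    incrementSq Y K n ω ≤ incrementSq Y K m ω :=
  Finset.sum_le_sum_of_subset_of_nonneg (Finset.range_mono h) fun _ _ _ => sq_nonneg _

/-- The vector of the values of the standardized realized quadratic variation of a rescaled Itô
integral over the grid is a measurable function of the Brownian path; its bias and variance are of
the order `1 / K`. -/
theorem exists_measurable_standardizedQV_vector {W : ℝ≥0 → Ω → ℝ} (hW : IsPreBrownianReal W P)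
    {ν : ℝ → ℝ} (hν : ContinuousOn ν (Set.Icc 0 1))
    {M m₀ : ℝ} (hm₀ : 0 < m₀) (hlow : ∀ u ∈ Set.Icc (0 : ℝ) 1, m₀ ≤ ν u)
    (hup : ∀ u ∈ Set.Icc (0 : ℝ) 1, ν u ≤ M) {K : ℕ} (hK : 0 < K) :
    ∃ Ψ : (ℝ≥0 → ℝ) → EuclideanSpace ℝ (Fin K), Measurable Ψ ∧
      MemLp (fun ω => Ψ fun t => W t ω) 2 P ∧
      ‖∫ ω, Ψ (fun t => W t ω) ∂P - gridVec (fun k => stdIntegratedSq ν ((k : ℝ) / K)) K‖ ≤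
        20 * ((∫ x, x ^ 4 ∂gaussianReal 0 1) * M ^ 4) / m₀ ^ 4 / K ∧
      ∫ ω, ‖Ψ (fun t => W t ω) - ∫ ω', Ψ (fun t => W t ω') ∂P‖ ^ 2 ∂P ≤
        20 * ((∫ x, x ^ 4 ∂gaussianReal 0 1) * M ^ 4) / m₀ ^ 4 / K ∧
      ∀ᵐ ω ∂P, ∀ (R : ℝ → ℝ) (r : ℝ), r ≠ 0 →
        (∀ k ≤ K, R ((k : ℝ) / K) = r * itoIntegral P W ν ((k : ℝ) / K) ω) →
        gridVec (fun k => standardizedQV R K ((k : ℝ) / K)) K = Ψ fun t => W t ω := by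
  have hK' : (0 : ℝ) < K := by exact_mod_cast hK
  have hgrid : ∀ k ≤ K, (k : ℝ) / K ≤ 1 := fun k hk => by
    rw [div_le_one hK']
    exact_mod_cast hk
  have hito : ∀ k ≤ K, IsItoIntegralAt P W ν ((k : ℝ) / K) (itoIntegral P W ν ((k : ℝ) / K)) :=
    fun k hk => isItoIntegralAt_itoIntegral hW hν (hgrid k hk)
  have hex : ∀ t : ℝ, ∃ Φ : (ℝ≥0 → ℝ) → ℝ, Measurable Φ ∧ (t ≤ 1 →
      itoIntegral P W ν t =ᵐ[P] fun ω => Φ fun s => W s ω) := by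
    intro t
    by_cases ht : t ≤ 1
    · obtain ⟨Φ, h1, h2⟩ := (isItoIntegralAt_itoIntegral hW hν ht).exists_measurable_path hW
      exact ⟨Φ, h1, fun _ => h2⟩
    · exact ⟨fun _ => 0, measurable_const, fun h => absurd h ht⟩
  choose Φ hΦ hΦW using hex
  set Y : ℝ → Ω → ℝ := fun t ω => Φ t fun s => W s ω with hY
  have hYito : ∀ k ≤ K, IsItoIntegralAt P W ν ((k : ℝ) / K) (Y ((k : ℝ) / K)) := by
    intro k hk
    have hae := hΦW _ (hgrid k hk)
    refine ⟨(hito k hk).1.ae_eq hae, (hito k hk).2.congr fun m => eLpNorm_congr_ae ?_⟩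
    filter_upwards [hae] with ω hω
    simp only [Pi.sub_apply, hω, hY]
  have hM : ∀ u ∈ Set.Icc (0 : ℝ) 1, |ν u| ≤ M := fun u hu => by
    rw [abs_of_pos (hm₀.trans_le (hlow u hu))]
    exact hup u hu
  have hinc := fun k (hk : k ≤ K) => incrementSq_isItoIntegralAt hW hν hM hK hk hYito
  have hτ : m₀ ^ 2 ≤ ∫ x in (0 : ℝ)..((K : ℝ) / K), ν x ^ 2 := by
    rw [div_self hK'.ne']
    have h1 : ∫ _ in (0 : ℝ)..1, m₀ ^ 2 = m₀ ^ 2 := by simp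
    rw [← h1]
    refine intervalIntegral.integral_mono_on zero_le_one intervalIntegrable_const
      ((hν.pow 2).intervalIntegrable_zero ⟨zero_le_one, le_rfl⟩) fun x hx => ?_
    have := hlow x hx
    gcongr
  obtain ⟨h1, h2, h3⟩ := gridVec_ratio_bias_and_variance (P := P)
    (A := fun k => incrementSq Y K k)
    (α := fun k => ∫ x in (0 : ℝ)..((k : ℝ) / K), ν x ^ 2) hK
    (fun k hk => (hinc k hk).1)
    (fun k ω => incrementSq_nonneg Y K k ω) (fun k hk ω => incrementSq_mono Y K ω hk)
    (fun k hk => (hinc k hk).2.1) (pow_pos hm₀ 2) hτ (fun k hk => (hinc k hk).2.2)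
  have hC : 0 ≤ ((∫ x, x ^ 4 ∂gaussianReal 0 1) * M ^ 4) :=
    mul_nonneg (integral_nonneg fun x => by positivity) (by positivity)
  set C := ((∫ x, x ^ 4 ∂gaussianReal 0 1) * M ^ 4) with hCdef
  -- The same quotient is formed on the path space, with the path functionals `Φ t` in the role of
  -- the process.
  refine ⟨fun w => gridVec (fun k => incrementSq Φ K k w / incrementSq Φ K K w) K, ?_, h1, ?_, ?_,
    ?_⟩
  · unfold gridVec
    refine (WithLp.measurable_toLp 2 _).comp (measurable_pi_lambda _ fun k => ?_)
    exact ((measurable_incrementSq hΦ K k).div (measurable_incrementSq hΦ K K)).div_const _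
  · have e : (fun k : ℕ => stdIntegratedSq ν ((k : ℝ) / K)) = fun k : ℕ =>
        (∫ x in (0 : ℝ)..((k : ℝ) / K), ν x ^ 2) / ∫ x in (0 : ℝ)..((K : ℝ) / K), ν x ^ 2 := by
      ext k
      rw [div_self hK'.ne', stdIntegratedSq]
    rw [e]
    refine h2.trans ?_
    calc 8 * (C / K) / (m₀ ^ 2) ^ 2 = 8 * C / m₀ ^ 4 / K := by field_simp
      _ ≤ 20 * C / m₀ ^ 4 / K := by
        gcongr
        norm_num
  · refine h3.trans (le_of_eq ?_)
    field_simp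
  · have hae : ∀ᵐ ω ∂P, ∀ k ∈ Finset.range (K + 1),
        itoIntegral P W ν ((k : ℝ) / K) ω = Y ((k : ℝ) / K) ω :=
      (Finset.eventually_all _).2 fun k hk =>
        hΦW _ (hgrid k (Nat.lt_succ_iff.1 (Finset.mem_range.1 hk)))
    -- The null set is fixed before `R` and `r` are chosen, so `r` may be an arbitrary, even
    -- non-measurable, function of `ω`. The factor `r²` cancels in the quotient.
    filter_upwards [hae] with ω hω R r hr hR
    have hRY : ∀ k ≤ K, R ((k : ℝ) / K) = r * Y ((k : ℝ) / K) ω := fun k hk => by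
      rw [hR k hk, hω k (Finset.mem_range.2 (Nat.lt_succ_iff.2 hk))]
    have hsq : ∀ n ≤ K, incrementSq (fun t (_ : Ω) => R t) K n ω =
        r ^ 2 * incrementSq Y K n ω := by
      intro n hn
      rw [incrementSq, incrementSq, Finset.mul_sum]
      refine Finset.sum_congr rfl fun k hk => ?_
      have hk' := (Finset.mem_range.1 hk).trans_le hn
      rw [hRY k hk'.le, hRY (k + 1) hk']
      ring
    ext k
    rw [gridVec_apply, gridVec_apply]
    congr 1
    have := standardizedQV_eq_div (fun t (_ : Ω) => R t) ω hK k.2.le (le_refl ((k : ℝ) / K))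
      (by gcongr; omega)
    rw [this, hsq k k.2.le, hsq K le_rfl, mul_div_mul_left _ _ (pow_ne_zero 2 hr)]
    rfl

end SampleVectors

/-! ### Probability bound for the estimator and choice of constants. -/

section Estimator

variable {Ω : Type*} [MeasurableSpace Ω] {P : Measure Ω} [IsProbabilityMeasure P]

/-- Non-asymptotic bound for the probability that the CUSUM objective is at least as large at some
point at distance at least `D` from the change point `k` as it is at `k`. -/
theorem measure_exists_cusum_ge_le {W : ℕ → ℝ≥0 → Ω → ℝ} (hWmeas : ∀ i t, Measurable (W i t))
    (hW : ∀ i, IsPreBrownianReal (W i) P) (hWindep : iIndepFun (fun i ω t => W i t ω) P)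
    {g : ℕ → Ω → ℝ} {ν : ℕ → ℝ → ℝ} {ν₁ ν₂ : ℝ → ℝ} {N K k : ℕ}
    (hν : ∀ i, ν i = if i ≤ k then ν₁ else ν₂)
    (hν₁ : ContinuousOn ν₁ (Set.Icc 0 1)) (hν₂ : ContinuousOn ν₂ (Set.Icc 0 1)) {m₀ M c D : ℝ}
    (hm₀ : 0 < m₀) (hν₁b : ∀ u ∈ Set.Icc (0 : ℝ) 1, m₀ ≤ ν₁ u ∧ ν₁ u ≤ M)
    (hν₂b : ∀ u ∈ Set.Icc (0 : ℝ) 1, m₀ ≤ ν₂ u ∧ ν₂ u ≤ M) (hK : 0 < K) (hN : 0 < N)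
    (hc : 0 < c) (hk1 : c * N ≤ k) (hk2 : (k : ℝ) ≤ (1 - c) * N) (hD : 0 < D)
    {R : ℕ → ℝ → Ω → ℝ}
    (hR : ∀ i ∈ Finset.Icc 1 N, ∀ t ∈ Set.Icc (0 : ℝ) 1,
      R i t =ᵐ[P] fun ω => Real.exp (g i ω) * itoIntegral P (W i) (ν i) t ω)
    {C d : ℝ} (hC : C = 20 * ((∫ x, x ^ 4 ∂gaussianReal 0 1) * M ^ 4) / m₀ ^ 4) (hd : 0 < d)
    (hδ : d ^ 2 ≤ ∑ j ∈ Finset.range K,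
      (stdIntegratedSq ν₁ ((j : ℝ) / K) - stdIntegratedSq ν₂ ((j : ℝ) / K)) ^ 2 / K)
    (hCK : C / K ≤ c ^ 2 / 32 * d) :
    P {ω | ∃ n ≤ N, D ≤ |(n : ℝ) - k| ∧
        cusum (fun i => standardizedQV (fun t => R i t ω) K) N k ≤
          cusum (fun i => standardizedQV (fun t => R i t ω) K) N n} ≤
      ENNReal.ofReal (C / K / ((c ^ 2 / 32 * d) ^ 2 * N)) +
        2 * ENNReal.ofReal (9 * (C / K) / ((c ^ 2 / 32 * d) ^ 2 * D)) := by
  have hK' : (0 : ℝ) < K := by exact_mod_cast hK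
  have hN' : (0 : ℝ) < N := by exact_mod_cast hN
  have hC0 : 0 ≤ C := by
    rw [hC]
    have : 0 ≤ ∫ x, x ^ 4 ∂gaussianReal 0 1 := integral_nonneg fun x => by positivity
    positivity
  set f₁ := gridVec (fun j => stdIntegratedSq ν₁ ((j : ℝ) / K)) K with hf₁
  set f₂ := gridVec (fun j => stdIntegratedSq ν₂ ((j : ℝ) / K)) K with hf₂
  have hdδ : d ≤ ‖f₁ - f₂‖ := by
    rw [← sq_le_sq₀ hd.le (norm_nonneg _), hf₁, hf₂, gridVec_sub, norm_sq_gridVec]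
    exact hδ
  have hne : f₁ ≠ f₂ := by
    intro h
    rw [h, sub_self, norm_zero] at hdδ
    linarith
  have hνc : ∀ i, ContinuousOn (ν i) (Set.Icc 0 1) := fun i => by
    rw [hν i]
    split_ifs <;> assumption
  have hνb : ∀ i, ∀ u ∈ Set.Icc (0 : ℝ) 1, m₀ ≤ ν i u ∧ ν i u ≤ M := fun i => by
    rw [hν i]
    split_ifs <;> assumption
  choose Ψ hΨm hΨ2 hΨb hΨv hΨR using fun i => exists_measurable_standardizedQV_vector (hW i)
    (hνc i) hm₀ (fun u hu => (hνb i u hu).1) (fun u hu => (hνb i u hu).2) hK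
  have hpath : ∀ i, Measurable fun ω => fun t => W i t ω := fun i =>
    measurable_pi_lambda _ (hWmeas i)
  have hfi : ∀ i, gridVec (fun j => stdIntegratedSq (ν i) ((j : ℝ) / K)) K =
      if i ≤ k then f₁ else f₂ := fun i => by
    rw [hν i]
    split_ifs <;> rfl
  -- Bias and variance are both bounded by `C / K`; the true jump is replaced by its lower bound `d`
  -- only at the end.
  have key := measure_exists_norm_cusumVec_ge_le (P := P)
    (X := fun i ω => Ψ i fun t => W i t ω) (N := N) (k := k) (c := c) (D := D) (v := C / K)
    (β := C / K)
    (fun i => ((hΨm i).comp (hpath i)).stronglyMeasurable) (hWindep.comp Ψ hΨm) hΨ2 hne hc hN hk1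
    hk2 hD (fun i => by
      rw [← hfi, hC]
      exact hΨb i)
    (hCK.trans (by gcongr)) (fun i => by
      rw [hC]
      exact hΨv i)
  have hCK0 : 0 ≤ C / K := by positivity
  refine le_trans (le_trans (measure_mono_ae ?_) key) ?_
  · have hae : ∀ᵐ ω ∂P, ∀ i ∈ Finset.Icc 1 N, ∀ j ∈ Finset.range (K + 1),
        R i ((j : ℝ) / K) ω = Real.exp (g i ω) * itoIntegral P (W i) (ν i) ((j : ℝ) / K) ω := by
      refine (Finset.eventually_all _).2 fun i hi => (Finset.eventually_all _).2 fun j hj =>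
        hR i hi _ ⟨by positivity, ?_⟩
      rw [div_le_one hK']
      exact_mod_cast Nat.lt_succ_iff.1 (Finset.mem_range.1 hj)
    filter_upwards [hae, ae_all_iff.2 hΨR] with ω hω hωΨ
    rintro ⟨n, hn, hDn, hcus⟩
    have hkN : k ≤ N := by
      have : (k : ℝ) ≤ N := by nlinarith
      exact_mod_cast this
    have hvec : ∀ m ≤ N, cusum (fun i => standardizedQV (fun t => R i t ω) K) N m =
        ‖cusumVec (fun i => Ψ i fun t => W i t ω) N m‖ ^ 2 := by
      intro m hm
      rw [cusum_eq_norm_sq_cusumVec (r := fun i j =>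
        standardizedQV (fun t => R i t ω) K ((j : ℝ) / K)) hK]
      · have e : ∀ m ≤ N, ∑ i ∈ Finset.Icc 1 m,
            gridVec (fun j => standardizedQV (fun t => R i t ω) K ((j : ℝ) / K)) K =
              ∑ i ∈ Finset.Icc 1 m, Ψ i fun t => W i t ω := by
          intro m hm
          refine Finset.sum_congr rfl fun i hi => ?_
          have hi' := Finset.mem_Icc.1 hi
          exact hωΨ i _ _ (Real.exp_pos (g i ω)).ne' fun j hj =>
            hω i (Finset.mem_Icc.2 ⟨hi'.1, hi'.2.trans hm⟩) j
              (Finset.mem_range.2 (Nat.lt_succ_iff.2 hj))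
        rw [cusumVec, cusumVec, e m hm, e N le_rfl]
      · intro i j hj u hu
        have hlt : (j : ℝ) / K < ((j + 1 : ℕ) : ℝ) / K := by
          gcongr
          omega
        rw [standardizedQV_eq_div (R i) ω hK hj.le hu.1.le hu.2,
          standardizedQV_eq_div (R i) ω hK hj.le le_rfl hlt]
    rw [hvec k hkN, hvec n hn] at hcus
    exact ⟨n, hn, hDn, (sq_le_sq₀ (norm_nonneg _) (norm_nonneg _)).1 hcus⟩
  · gcongr

/-- The first bound uses that `a √(N K)` is large. The second uses `a² K (N r) ≥ 1`, after which `L`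
is just large enough to leave `ε / 4`. -/
lemma div_add_rate_bounds {C γ ε a K N r L : ℝ} (hC : 0 ≤ C) (hγ : 0 < γ) (hε : 0 < ε)
    (ha : 0 < a) (hK : 0 < K) (hN : 0 < N) (hr : a⁻¹ ^ 2 / (N * K) ≤ r) (hr₀ : 0 < r)
    (hL : L = 36 * (C + 1) / (γ ^ 2 * ε)) (haNK : √(2 * C / (γ ^ 2 * ε)) ≤ a * √(N * K)) :
    C / K / ((γ * a) ^ 2 * N) ≤ ε / 2 ∧
      9 * (C / K) / ((γ * a) ^ 2 * (L * (N * r))) ≤ ε / 4 := by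
  have hL0 : 0 < L := by
    rw [hL]
    positivity
  constructor
  · have hsq : 2 * C / (γ ^ 2 * ε) ≤ a ^ 2 * (N * K) := by
      have h := pow_le_pow_left₀ (Real.sqrt_nonneg _) haNK 2
      rwa [Real.sq_sqrt (by positivity), mul_pow, Real.sq_sqrt (by positivity)] at h
    rw [div_le_iff₀ (by positivity)] at hsq
    rw [div_div, div_le_iff₀ (by positivity)]
    linarith
  · have h1 : 1 ≤ a ^ 2 * K * (N * r) := by
      rw [div_le_iff₀ (by positivity), inv_pow, inv_le_iff_one_le_mul₀ (by positivity)] at hr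
      linarith
    have h2 : γ ^ 2 * ε * L = 36 * (C + 1) := by
      rw [hL]
      field_simp
    have e : 9 * (C / K) / ((γ * a) ^ 2 * (L * (N * r))) =
        9 * C / (γ ^ 2 * L * (a ^ 2 * K * (N * r))) := by
      field_simp
    rw [e, div_le_iff₀ (by positivity)]
    have h3 : ε / 4 * (γ ^ 2 * L * 1) ≤ ε / 4 * (γ ^ 2 * L * (a ^ 2 * K * (N * r))) := by
      gcongr
    linarith

/-- Replacing `N θ` by its integer part costs at most `1 / N ≤ r`, whence `L + 1` in place of `L`.
-/
lemma abs_div_sub_le_of_abs_sub_floor_lt {n k N θ L r : ℝ} (hN : 0 < N) (hk : k ≤ N * θ)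
    (hk' : N * θ < k + 1) (hr : 1 / N ≤ r) (h : |n - k| < L * (N * r)) :
    |n / N - θ| ≤ (L + 1) * r := by
  have e : n / N - θ = (n - k) / N + (k - N * θ) / N := by
    field_simp
    ring
  have h1 : |(n - k) / N| ≤ L * r := by
    rw [abs_div, abs_of_pos hN, div_le_iff₀ hN]
    linarith
  have h2 : |(k - N * θ) / N| ≤ r := by
    rw [abs_div, abs_of_pos hN]
    refine le_trans ?_ hr
    gcongr
    rw [abs_le]
    constructor <;> linarith
  have h3 := abs_add_le ((n - k) / N) ((k - N * θ) / N)
  rw [← e] at h3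
  linarith

lemma floor_mul_bounds {θ c N : ℝ} {k : ℕ} (hN : 0 < N) (hNθ : 2 / θ ≤ N) (hθ : 0 < θ)
    (hc : c ≤ θ / 2) (hc' : c ≤ 1 - θ) (hk : (k : ℝ) ≤ N * θ) (hk' : N * θ < k + 1) :
    c * N ≤ k ∧ (k : ℝ) ≤ (1 - c) * N := by
  -- This absorbs the loss of the floor: `k > N θ - 1 ≥ N θ / 2`.
  have hNθ1 : 1 ≤ N * (θ / 2) := by
    rw [div_le_iff₀ hθ] at hNθ
    linarith
  have h1 : c * N ≤ θ / 2 * N := by gcongr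
  have h2 : c * N ≤ (1 - θ) * N := by gcongr
  constructor <;> linarith

end Estimator

/-- Rate of the CUSUM argmax estimator under local alternatives in the shape of the volatility. -/
theorem theorem4p3 {Ω : Type*} [MeasurableSpace Ω] (P : Measure Ω) [IsProbabilityMeasure P]
    -- independent standard Wiener processes
    (W : ℕ → ℝ≥0 → Ω → ℝ)
    (hWmeas : ∀ i t, Measurable (W i t))
    (hW : ∀ i, IsBrownianReal (W i) P)
    (hWindep : iIndepFun (fun i ω t => W i t ω) P)
    -- the scaling factors `exp (g i)` are arbitrary
    (g : ℕ → Ω → ℝ)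
    -- the volatility functions and the local alternatives
    (σ₁ σtilde : ℝ → ℝ)
    (hσ₁_cont : ContinuousOn σ₁ (Set.Icc 0 1)) (hσ₁_pos : ∀ u ∈ Set.Icc (0 : ℝ) 1, 0 < σ₁ u)
    (hσt_cont : ContinuousOn σtilde (Set.Icc 0 1))
    (hσt_pos : ∀ u ∈ Set.Icc (0 : ℝ) 1, 0 < σtilde u)
    (hratio : ¬ ∃ c : ℝ, ∀ u ∈ Set.Icc (0 : ℝ) 1, σtilde u / σ₁ u = c)
    (a : ℕ → ℝ) (ha_pos : ∀ N, 0 < a N) (ha_bdd : ∃ B : ℝ, ∀ N, a N ≤ B)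
    -- the number of grid points `K = K_N` and the growth conditions
    (K : ℕ → ℕ) (hK : Tendsto K atTop atTop)
    (hgrowth₁ : Tendsto (fun N : ℕ => a N * √((N : ℝ) * K N)) atTop atTop)
    (hgrowth₂ : Tendsto (fun N : ℕ => a N * (K N : ℝ)) atTop atTop)
    (θ : ℝ) (hθ₀ : 0 < θ) (hθ₁ : θ < 1)
    -- the sample `R N 1, …, R N N` of curves, with a change at `⌊N θ⌋`
    (R : ℕ → ℕ → ℝ → Ω → ℝ)
    (hR : ∀ N, ∀ i ∈ Finset.Icc 1 N, ∀ t ∈ Set.Icc (0 : ℝ) 1,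
      R N i t =ᵐ[P] fun ω => Real.exp (g i ω) *
        itoIntegral P (W i) (changeVolatility σ₁ (fun u => σ₁ u + a N * σtilde u) θ N i) t ω)
    -- the estimator: any choice of a maximizer
    (θhat : ℕ → Ω → ℝ)
    (hθhat : ∀ N, 1 ≤ N → ∀ ω,
      IsCusumArgmax (fun i => standardizedQV (fun t => R N i t ω) (K N)) N (θhat N ω)) :
    IsBigOInProbability P (fun N ω => θhat N ω - θ)
      (fun N => max ((a N)⁻¹ ^ 2 / ((N : ℝ) * K N)) (1 / (N : ℝ))) := by
  obtain ⟨B, hB⟩ := ha_bdd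
  have hB0 : 0 < B := (ha_pos 0).trans_le (hB 0)
  have hne : (Set.Icc (0 : ℝ) 1).Nonempty := ⟨0, le_rfl, zero_le_one⟩
  obtain ⟨u₀, hu₀, hmin⟩ := isCompact_Icc.exists_isMinOn hne hσ₁_cont
  obtain ⟨u₁, hu₁, hmax⟩ := isCompact_Icc.exists_isMaxOn hne hσ₁_cont
  obtain ⟨u₂, hu₂, hmaxt⟩ := isCompact_Icc.exists_isMaxOn hne hσt_cont
  set m₀ := σ₁ u₀ with hm₀def
  have hm₀ : 0 < m₀ := hσ₁_pos u₀ hu₀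
  set M := σ₁ u₁ + B * σtilde u₂ with hM
  have hlow : ∀ u ∈ Set.Icc (0 : ℝ) 1, m₀ ≤ σ₁ u := fun u hu => hmin hu
  have hup : ∀ u ∈ Set.Icc (0 : ℝ) 1, σ₁ u ≤ σ₁ u₁ := fun u hu => hmax hu
  have hupt : ∀ u ∈ Set.Icc (0 : ℝ) 1, σtilde u ≤ σtilde u₂ := fun u hu => hmaxt hu
  have hBt : 0 ≤ B * σtilde u₂ := (mul_pos hB0 (hσt_pos u₂ hu₂)).le
  obtain ⟨c₁, hc₁, K₀, hsignal⟩ := exists_mul_sq_le_sum_grid_stdIntegratedSq hσ₁_cont hσ₁_pos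
    hσt_cont hσt_pos hratio hB0.le
  obtain ⟨C, hC⟩ : ∃ C, C = 20 * ((∫ x, x ^ 4 ∂gaussianReal 0 1) * M ^ 4) / m₀ ^ 4 := ⟨_, rfl⟩
  have hC0 : 0 ≤ C := by
    rw [hC]
    have : 0 ≤ ∫ x, x ^ 4 ∂gaussianReal 0 1 := integral_nonneg fun x => by positivity
    positivity
  set c := min θ (1 - θ) / 2 with hc
  have hc0 : 0 < c := by
    have : 0 < min θ (1 - θ) := lt_min hθ₀ (by linarith)
    positivity
  have hcθ : c ≤ θ / 2 := by
    rw [hc]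
    gcongr
    exact min_le_left _ _
  have hcθ' : c ≤ 1 - θ := by
    have := min_le_right θ (1 - θ)
    rw [hc]
    linarith
  -- The jump is at least `√c₁ * a N`, so the noise threshold per observation is `γ * a N`.
  set γ := c ^ 2 / 32 * √c₁ with hγ
  have hγ0 : 0 < γ := by positivity
  clear_value c γ
  intro ε hε
  obtain ⟨L, hL⟩ : ∃ L, L = 36 * (C + 1) / (γ ^ 2 * ε) := ⟨_, rfl⟩
  have hL0 : 0 < L := by
    rw [hL]
    positivity
  have hev : ∀ᶠ N : ℕ in atTop, 1 ≤ N ∧ 2 / θ ≤ (N : ℝ) ∧ max K₀ 1 ≤ K N ∧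
      C / γ ≤ a N * (K N : ℝ) ∧ √(2 * C / (γ ^ 2 * ε)) ≤ a N * √((N : ℝ) * K N) := by
    filter_upwards [eventually_ge_atTop 1, tendsto_natCast_atTop_atTop.eventually_ge_atTop (2 / θ),
      hK.eventually_ge_atTop (max K₀ 1), hgrowth₂.eventually_ge_atTop (C / γ),
      hgrowth₁.eventually_ge_atTop (√(2 * C / (γ ^ 2 * ε)))] with N h1 h2 h3 h4 h5
    exact ⟨h1, h2, h3, h4, h5⟩
  obtain ⟨N₀, hN₀⟩ := eventually_atTop.1 hev
  refine ⟨L + 1, by positivity, N₀, fun N hN => ?_⟩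
  obtain ⟨hN1, hNθ, hKN, haK, haNK⟩ := hN₀ N hN
  have hN' : (0 : ℝ) < N := by exact_mod_cast hN1
  have hKpos : 0 < K N := lt_of_lt_of_le Nat.zero_lt_one ((le_max_right _ _).trans hKN)
  have hK' : (0 : ℝ) < K N := by exact_mod_cast hKpos
  have ha := ha_pos N
  set r := max ((a N)⁻¹ ^ 2 / ((N : ℝ) * K N)) (1 / (N : ℝ)) with hr
  have hr1 : 1 / (N : ℝ) ≤ r := le_max_right _ _
  have hr2 : (a N)⁻¹ ^ 2 / ((N : ℝ) * K N) ≤ r := le_max_left _ _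
  have hr0 : 0 < r := lt_of_lt_of_le (by positivity) hr1
  set k := ⌊(N : ℝ) * θ⌋₊ with hk
  have hkle : (k : ℝ) ≤ N * θ := Nat.floor_le (by positivity)
  have hkge : (N : ℝ) * θ < k + 1 := Nat.lt_floor_add_one _
  obtain ⟨hk1, hk2⟩ := floor_mul_bounds hN' hNθ hθ₀ hcθ hcθ' hkle hkge
  have hkpos : 1 ≤ k := by
    have : (0 : ℝ) < k := lt_of_lt_of_le (by positivity) hk1
    exact_mod_cast this
  have hkN : k ≤ N := by
    have : (k : ℝ) ≤ N := hkle.trans (mul_le_of_le_one_right hN'.le hθ₁.le)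
    exact_mod_cast this
  have haux : c ^ 2 / 32 * (√c₁ * a N) = γ * a N := by
    rw [hγ]
    ring
  -- The radius `D = L * (N * r)` is the claimed rate on the scale of indices. The largeness of `a N
  -- * K N` is what puts the bias below the threshold.
  have hbound := measure_exists_cusum_ge_le (P := P) (g := g) (N := N) (K := K N) (k := k)
    (R := R N) (ν := fun i => changeVolatility σ₁ (fun u => σ₁ u + a N * σtilde u) θ N i)
    (ν₁ := σ₁) (ν₂ := fun u => σ₁ u + a N * σtilde u) (m₀ := m₀) (M := M) (c := c)
    (D := L * (N * r)) (d := √c₁ * a N) hWmeas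
    (fun i => (hW i).toIsPreBrownianReal) hWindep (fun i => rfl) hσ₁_cont
    (hσ₁_cont.add (continuousOn_const.mul hσt_cont)) hm₀
    (fun u hu => ⟨hlow u hu, (hup u hu).trans (by rw [hM]; linarith)⟩)
    (fun u hu => ⟨(hlow u hu).trans (by nlinarith [hσt_pos u hu]), by
      have h1 : a N * σtilde u ≤ B * σtilde u₂ :=
        mul_le_mul (hB N) (hupt u hu) (hσt_pos u hu).le hB0.le
      have := hup u hu
      rw [hM]
      linarith⟩)
    hKpos hN1 hc0 hk1 hk2 (by positivity) (hR N) hC (by positivity)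
    (by
      rw [mul_pow, Real.sq_sqrt hc₁.le]
      exact hsignal (K N) ((le_max_left _ _).trans hKN) (a N) ⟨ha.le, hB N⟩)
    (by
      rw [haux, div_le_iff₀ hK']
      rw [div_le_iff₀ hγ0] at haK
      linarith)
  rw [haux] at hbound
  refine (measure_mono ?_).trans (hbound.trans ?_)
  · intro ω hω
    obtain ⟨n, hn, hmaxn, hθn⟩ := hθhat N hN1 ω
    have hn' := Finset.mem_Icc.1 hn
    refine ⟨n, hn'.2, ?_, hmaxn k (Finset.mem_Icc.2 ⟨hkpos, hkN⟩)⟩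
    -- A maximizer does at least as well as `k`, so it lies in the bad event unless it is within `D`
    -- of `k`; in that case the error is within the claimed rate.
    by_contra! hlt
    have hω' : (L + 1) * r < |θhat N ω - θ| := hω
    rw [hθn] at hω'
    exact hω'.not_ge (abs_div_sub_le_of_abs_sub_floor_lt hN' hkle hkge hr1 hlt)
  · obtain ⟨hfirst, hsecond⟩ :=
      div_add_rate_bounds hC0 hγ0 hε ha hK' hN' hr2 hr0 hL haNK
    calc _ ≤ ENNReal.ofReal (ε / 2) + 2 * ENNReal.ofReal (ε / 4) := by gcongr
      _ = ENNReal.ofReal ε := by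
        rw [two_mul, ← ENNReal.ofReal_add (by positivity) (by positivity),
          ← ENNReal.ofReal_add (by positivity) (by positivity)]
        congr 1
        ring
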